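/- **Proposition 7.3.** Let $(X,d,\nu)$ be a computable metric space: a metric space with a dense sequence $\nu:\mathbb N\to X$ such that $(d(\nu(i),\nu(j)))_{i,j}$ is a computable double sequence of reals. Fix standard computable bijective codings $\langle\cdot\rangle$ of pairs and finite words of natural numbers, and a standard numbering $\nu_{\mathbb Q^+}$ of the positive rationals. Let $\alpha\langle i,r\rangle:=B(\nu(i),\nu_{\mathbb Q^+}(r))$; for $w\in\mathbb N^*$ let $U\langle w\rangle:=\bigcup_{i<|w|}\alpha(w_i)$ (an *ideal cover*). Ideal covers $u,v$ are *formally disjoint* if $d(\nu(a),\nu(b))>\nu_{\mathbb Q^+}(r)+\nu_{\mathbb Q^+}(q)$ for all entries $\langle a,r\rangle$ of $u$ and $\langle b,q\rangle$ of $v$. Computability is that of the representation approach (computable realisers on Baire space $\mathbb N^{\mathbb N}$), with $n\in\mathbb N$ named by the $p$ with $p_0=n$, with the usual product and sequence representations, and with the following representations. * Open sets $\Sigma^0_1(X)$: $p$ names $\bigcup\{\alpha(p_i-1)\mid p_i\ge 1\}$. * Clopen sets $\Delta^0_1(X)$: $\langle p,q\rangle$ names $W$ if $p$ names the open set $W$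 and $q$ names the open set $X\setminus W$. * Compact sets $\mathcal K_{>}(X)$ (including $\emptyset$), with representation $\delta_c$: $p$ names $K$ if $\{p_i\mid i\in\mathbb N\}=\{\langle w\rangle\mid w\in\mathbb N^*,\ K\subseteq U\langle w\rangle\}$. * Compact open sets $\mathcal{KO}(X)$: $\langle p,q\rangle$ names $K$ if $p$ names $K$ as a clopen set and $q$ names $K$ as a compact set. * Compact sets of covering dimension $\le 0$, with representation $\delta_{dc}$: $p$ names $K$ if $\{a\mid(\exists i)\,p_i=a+1\}$ is the set of all $\langle\langle w^{(0)}\rangle,\dots,\langle w^{(l-1)}\rangle\rangle$ with $l\in\mathbb N$, $w^{(i)}\in\mathbb N^*$ pairwise formally disjoint and $K\subseteq\bigcup_{i<l}U\langle w^{(i)}\rangle$. Sequences in $\mathbb Z^+$ and in $\{0,1\}$ are represented by themselves. Let $\hat D$ be the multi-valued operation from $\Sigma^0_1(X)\times\mathcal K_{>}(X)$ to $\Delta^0_1(X)^{\mathbb N}\times(\mathbb Z^+)^{\mathbb N}\times\{0,1\}^{\mathbb N}$ with domain $\{(U,K)\mid U\subseteq K\}$ such that $((W_i)_i,r,s)\in\hat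 D(U,K)$ iff the $W_i$ are pairwise disjoint, $\bigcup_iW_i=U\subseteq K$, $(\forall i)(W_i=\emptyset\iff s_i=0)$, and $\operatorname{diam}W_{\sum_{i<n}r_i+j}<(n+1)^{-1}$ for all $n$ and all $j<r_n$. (In particular, computability of $\hat D$ includes that $\hat D(U,K)\neq\emptyset$ whenever $U\subseteq K$.) Consider the following conditions. 1. $X$ is $\delta_{dc}$-computable, i.e. $X$ is compact of covering dimension $\le 0$ and has a computable $\delta_{dc}$-name. 2. There exist a basis $\mathcal B$ for the topology of $X$ and a computable $b:\mathbb N\to\mathcal{KO}(X)$ with $\operatorname{im} b=\mathcal B$. 3. The operation $\hat D$ is computable, and there exists a computable $\gamma:\mathbb N\to\Sigma^0_1(X)\times\mathcal K_{>}(X)$, $\gamma(a)=(U_a,K_a)$, such that $\{U_a\mid a\in\mathbb N\}$ is a basis for the topology of $X$ and $U_a\subseteq K_a$ for all $a$. 4. There exist a computable $b:\mathbb N\to\Delta^0_1(X)$ such that $\operatorname{im} b$ is a basis for the topology of $X$, and a c.e. refined inclusion of $b$ with respect to $\alpha$, i.e. a c.e. relation $\sqsubset'\subseteq\mathbb N^2$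 with $c\sqsubset' e\implies b(c)\subseteq\alpha(e)$, and such that for all $e$ and all $x\in\alpha(e)$ there is $c$ with $x\in b(c)$ and $c\sqsubset' e$. Then $(1)\implies(2)\iff(3)\implies(4)$. -/

import Mathlib

open Set TopologicalSpace

namespace EffZeroDim

/-! ### Type-2 computability on Baire space -/

/-- Baire space `ℕ^ℕ`. -/
abbrev Baire := ℕ → ℕ

/-- The finite prefix `p 0, …, p (k - 1)`. -/
def Baire.pre (p : Baire) (k : ℕ) : List ℕ := (List.range k).map p

/-- Binary tupling on Baire space is `⟨p, q⟩ (2 i) = p i`, `⟨p, q⟩ (2 i + 1) = q i`;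
`Baire.fst` and `Baire.snd` are its two projections. -/
def Baire.fst (p : Baire) : Baire := fun i => p (2 * i)

/-- See `Baire.fst`. -/
def Baire.snd (p : Baire) : Baire := fun i => p (2 * i + 1)

/-- The `i`-th component of a countable tuple, `⟨p⁰, p¹, …⟩ ⟨i, j⟩ = pⁱ j`. -/
def Baire.component (p : Baire) (i : ℕ) : Baire := fun j => p (Nat.pair i j)

/-- `φ` describes a (deterministic) machine with input tape `p`: to find the `n`-th output digit it
reads longer and longer finite prefixes `w` of its input until `φ w n` gives an answer.
`Produces φ p q` says that on input `p` all output digits are found and the output is `q`. For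
computable `φ`, the partial functions `p ↦ q` arising in this way are exactly
the computable partial functions from Baire space to itself (with their natural domains). -/
def Produces (φ : List ℕ → ℕ → Option ℕ) (p q : Baire) : Prop :=
  ∀ n, ∃ k, φ (p.pre k) n = some (q n) ∧ ∀ j < k, φ (p.pre j) n = none

/-! ### Representations -/

/-- A representation of `A`, given by its graph: `δ p a` means that `p` is a `δ`-name of `a`. -/
abbrev Rep (A : Type*) := Baire → A → Prop

/-- The point `a` has a computable `δ`-name. -/
def ComputablePoint {A : Type*} (δ : Rep A) (a : A) : Prop :=
  ∃ p : Baire, Computable p ∧ δ p a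

/-- The multi-valued operation `f` with domain `dom` has a computable `(δ, δ')`-realiser, that
is, a computable partial function on Baire space which sends every name of every `a ∈ dom` to a
name of some member of `f a`. -/
def ComputableOp {A B : Type*} (δ : Rep A) (δ' : Rep B) (dom : Set A) (f : A → Set B) : Prop :=
  ∃ φ : List ℕ → ℕ → Option ℕ, Computable₂ φ ∧
    ∀ (p : Baire) (a : A), δ p a → a ∈ dom →
      ∃ (q : Baire) (b : B), Produces φ p q ∧ δ' q b ∧ b ∈ f a

/-- Computability of a total single-valued map between represented spaces. -/
def ComputableMap {A B : Type*} (δ : Rep A) (δ' : Rep B) (f : A → B) : Prop :=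
  ComputableOp δ δ' univ (fun a => {f a})

/-- The representation of `ℕ`: the name `p` represents `p 0`. -/
def natRep : Rep ℕ := fun p n => p 0 = n

/-- The product representation `[δ, δ']`. -/
def prodRep {A B : Type*} (δ : Rep A) (δ' : Rep B) : Rep (A × B) :=
  fun p x => δ p.fst x.1 ∧ δ' p.snd x.2

/-- The sequence representation `δ^ω`. -/
def seqRep {A : Type*} (δ : Rep A) : Rep (ℕ → A) :=
  fun p x => ∀ i, δ (p.component i) (x i)

/-- Sequences of positive integers, as points of Baire space, named by themselves. -/
def posSeqRep : Rep (ℕ → ℕ+) := fun p r => ∀ i, p i = (r i : ℕ)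

/-- Sequences of zeros and ones, as points of Baire space, named by themselves. -/
def bitSeqRep : Rep (ℕ → Fin 2) := fun p s => ∀ i, p i = (s i : ℕ)

/-! ### Computable metric spaces -/

/-- A computable metric space: a metric space with a dense sequence `ν` such that the distances
`d (ν i) (ν j)` form a computable double sequence of reals (a computable `f` gives, for
all `i`, `j`, `k`, a dyadic approximation up to `2^(-k)`). -/
class ComputableMetricSpace (X : Type*) extends MetricSpace X where
  ν : ℕ → X
  dense_ν : DenseRange ν
  computable_dist : ∃ f : ℕ × ℕ × ℕ → ℕ, Computable f ∧
    ∀ i j k, |dist (ν i) (ν j) - (f (i, j, k) : ℝ) / 2 ^ k| ≤ 1 / 2 ^ k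

/-- A total numbering of the positive rationals. -/
def posRat (r : ℕ) : ℚ := ((r.unpair.1 : ℚ) + 1) / ((r.unpair.2 : ℚ) + 1)

section

variable (X : Type*) [ComputableMetricSpace X]

/-- The centre of the ideal ball with index `a`. -/
def center (a : ℕ) : X := ComputableMetricSpace.ν a.unpair.1

/-- The radius of the ideal ball with index `a`. -/
noncomputable def radius (a : ℕ) : ℝ := (posRat a.unpair.2 : ℝ)

/-- The numbering `α` of the ideal open balls, `α ⟨i, r⟩ = B (ν i, posRat r)`. -/
def idealBall (a : ℕ) : Set X := Metric.ball (center X a) (radius a)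

/-- The union `U⟨w⟩` of the finitely many ideal balls with indices in the word `w`. -/
def idealCover (w : List ℕ) : Set X := ⋃ a ∈ w, idealBall X a

/-- Two ideal covers are formally disjoint. -/
def FormallyDisjoint (u v : List ℕ) : Prop :=
  ∀ a ∈ u, ∀ b ∈ v, radius a + radius b < dist (center X a) (center X b)

/-- The open set named by `p`: the union of all `α (p i - 1)` with `p i ≥ 1`. -/
def openSet (p : Baire) : Set X := ⋃ (i : ℕ) (_ : 1 ≤ p i), idealBall X (p i - 1)

/-- The representation of the open subsets of `X`. -/
def openRep : Rep (Opens X) := fun p U => openSet X p = (U : Set X)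

/-- The representation of the clopen subsets of `X`: names as an open and as a closed set. -/
def clopenRep : Rep (Clopens X) :=
  fun p W => openSet X p.fst = (W : Set X) ∧ (openSet X p.snd)ᶜ = (W : Set X)

/-- The representation `δ_c` of the compact subsets of `X`: a name lists (the codes of) all ideal
covers which cover the compact set. -/
def compactRep : Rep (Compacts X) := fun p K =>
  range p = {a | ∃ w : List ℕ, (K : Set X) ⊆ idealCover X w ∧ a = Encodable.encode w}

/-- The representation of the compact open subsets of `X`, which combines a name as a clopen
set and a name as a compact set. -/
def compactOpenRep : Rep (CompactOpens X) :=
  fun p K => clopenRep X p.fst K.toClopens ∧ compactRep X p.snd K.toCompacts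

end

/-- Covering dimension at most `n`: every finite open cover has a finite open refinement (which
is a cover) of order at most `n + 1`, that is, any `n + 2` members with distinct indices have
empty intersection. -/
def CoveringDimLE (Y : Type*) [TopologicalSpace Y] (n : ℕ) : Prop :=
  ∀ (k : ℕ) (U : Fin k → Set Y), (∀ i, IsOpen (U i)) → ⋃ i, U i = univ →
    ∃ (m : ℕ) (V : Fin m → Set Y), (∀ j, IsOpen (V j)) ∧ ⋃ j, V j = univ ∧
      (∀ j, ∃ i, V j ⊆ U i) ∧
      ∀ w : Fin (n + 2) → Fin m, Function.Injective w → ⋂ l, V (w l) = ∅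

section

variable (X : Type*) [ComputableMetricSpace X]

/-- The compact subsets of `X` of dimension at most zero. -/
abbrev ZeroDimCompacts := {K : Compacts X // CoveringDimLE (K : Set X) 0}

/-- The representation `δ_dc`: a name is a padded list of (the codes of) all tuples of
pairwise formally disjoint ideal covers which together cover the set. -/
def dcRep : Rep (ZeroDimCompacts X) := fun p K =>
  {a | ∃ ws : List (List ℕ), (K.1 : Set X) ⊆ ⋃ w ∈ ws, idealCover X w ∧
      ws.Pairwise (FormallyDisjoint X) ∧ a = Encodable.encode (ws.map Encodable.encode)} =
    {a | ∃ i, p i = a + 1}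

/-- The domain of the decomposition operation: all `(U, K)` with `U ⊆ K`. -/
def decompositionDom : Set (Opens X × Compacts X) := {x | (x.1 : Set X) ⊆ (x.2 : Set X)}

/-- The decomposition operation. -/
def decomposition (x : Opens X × Compacts X) :
    Set (((ℕ → Clopens X) × (ℕ → ℕ+)) × (ℕ → Fin 2)) :=
  {y | ∃ (W : ℕ → Clopens X) (r : ℕ → ℕ+) (s : ℕ → Fin 2), y = ((W, r), s) ∧
    (∀ i j, i ≠ j → Disjoint (W i : Set X) (W j : Set X)) ∧
    ⋃ i, (W i : Set X) = (x.1 : Set X) ∧ (x.1 : Set X) ⊆ (x.2 : Set X) ∧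
    (∀ i, (W i : Set X) = ∅ ↔ s i = 0) ∧
    ∀ n : ℕ, ∀ j < (r n : ℕ),
      Metric.diam (W (∑ i ∈ Finset.range n, (r i : ℕ) + j) : Set X) < ((n : ℝ) + 1)⁻¹}

/-- The decomposition operation is computable. -/
def DecompositionComputable : Prop :=
  ComputableOp (prodRep (openRep X) (compactRep X))
    (prodRep (prodRep (seqRep (clopenRep X)) posSeqRep) bitSeqRep)
    (decompositionDom X) (decomposition X)

/-- The whole space is a compact set of dimension at most zero and has a computable
`δ_dc`-name. -/
def DcComputable : Prop :=
  ∃ K : ZeroDimCompacts X, (K.1 : Set X) = univ ∧ ComputablePoint (dcRep X) K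

/-- `R` is a refined inclusion of `β` with respect to `β'`: a formal inclusion, such
that each point of a `β' d` lies in some `β c` with `R (c, d)`. -/
def IsRefinedInclusion {X : Type*} (R : ℕ × ℕ → Prop) (β β' : ℕ → Set X) : Prop :=
  (∀ c d, R (c, d) → β c ⊆ β' d) ∧ ∀ d, ∀ x ∈ β' d, ∃ c, x ∈ β c ∧ R (c, d)

/-- There is a computable enumeration, as compact open sets, of a basis of `X`. -/
def HasComputableCompactOpenBasis : Prop :=
  ∃ (𝓑 : Set (Set X)) (b : ℕ → CompactOpens X), IsTopologicalBasis 𝓑 ∧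
    ComputableMap natRep (compactOpenRep X) b ∧ range (fun n => (b n : Set X)) = 𝓑

/-- There is a computable sequence of pairs of an open set and a compact superset of it whose
first components form a basis of `X`. -/
def HasComputableBasisWithCompactSupersets : Prop :=
  ∃ γ : ℕ → Opens X × Compacts X,
    ComputableMap natRep (prodRep (openRep X) (compactRep X)) γ ∧
    IsTopologicalBasis (range fun a => ((γ a).1 : Set X)) ∧
    ∀ a, ((γ a).1 : Set X) ⊆ ((γ a).2 : Set X)

/-- There is a computable enumeration, as clopen sets, of a basis of `X`, with a c.e. refined
inclusion with respect to the ideal balls. -/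
def HasComputableClopenBasis : Prop :=
  ∃ (b : ℕ → Clopens X) (R : ℕ × ℕ → Prop),
    ComputableMap natRep (clopenRep X) b ∧ REPred R ∧
    IsRefinedInclusion R (fun n => (b n : Set X)) (idealBall X) ∧
    IsTopologicalBasis (range fun n => (b n : Set X))

end

end EffZeroDim

open EffZeroDim

/-! The engine is compactness: inclusion of a named compact set in a named open set is
semidecidable, because it already holds for a finite stage of the open name, and the compact name
lists every ideal cover of its set (`compactRep_subset_openSet`). For the same reason a compact set
minus an open set inherits a compact name (`compactRep_relName`).

Given a `δ_dc`-name of the space, each member of a listed tuple of pairwise formally disjoint covers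
has a clopen union, whose complement is the union of the other members. These unions form a
computable sequence of compact open sets. It enumerates a basis: dimension zero yields clopen
neighbourhoods (`exists_isClopen_of_coveringDimLE`), and every clopen set is exactly the first
member of some listed pair, built from balls small compared with the gap to the complement
(`exists_formallyDisjoint_of_isClopen`).

Given a compact open basis, an open set is exhausted by basic sets confirmed to lie in its listed
balls (`CompactOpenNames.iUnion_stageIndex`). The one at stage `k` is replaced by a finite nonempty
block of basic sets with the same union and diameters below `1 / (k + 1)`
(`CompactOpenNames.exists_blocks`). Concatenating the blocks and subtracting from each set all
earlier ones gives the disjoint pieces; the block lengths are the `r k`. Emptiness of a difference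
is decidable: emptiness is an inclusion of a compact set in an open one, and nonemptiness shows up
as a listed ball (`exists_emptinessBit`).

Conversely, decomposing the sets `U_a` inside `K_a` gives clopen pieces with compact names relative
to `K_a`, and these pieces again form a basis. Finally, listing the one-ball word `[e]` in the
compact name of `b c` is a c.e. refined inclusion. -/

namespace EffZeroDim

/-! ### Computable list operations, search, and uniform families of names -/

section Computability

open Encodable

variable {α σ : Type*} [Primcodable α] [Primcodable σ]

theorem computable_map_range {f : α → ℕ} {g : α → ℕ → σ} (hf : Computable f)
    (hg : Computable₂ g) : Computable fun a => (List.range (f a)).map (g a) := by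
  have h : Computable fun a => (Nat.rec [] (fun i l => l ++ [g a i]) (f a) : List σ) :=
    Computable.nat_rec (h := fun a (p : ℕ × List σ) => p.2 ++ [g a p.1]) hf (Computable.const [])
      (Computable.list_concat.comp (Computable.snd.comp Computable.snd)
        (hg.comp Computable.fst (Computable.fst.comp Computable.snd)))
  refine h.of_eq fun a => ?_
  induction f a with
  | zero => rfl
  | succ n ih => simp [List.range_succ, ih]

theorem computable_list_map {f : α → List ℕ} {g : α → ℕ → σ} (hf : Computable f)
    (hg : Computable₂ g) : Computable fun a => (f a).map (g a) := by
  have h : Computable₂ fun (a : α) (i : ℕ) => g a ((f a).getD i 0) :=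
    hg.comp Computable.fst
      ((Primrec.list_getD 0).to_comp.comp (hf.comp Computable.fst) Computable.snd)
  refine (computable_map_range (Computable.list_length.comp hf) h).of_eq fun a => ?_
  apply List.ext_getElem <;> simp +contextual

theorem exists_computable_find {P : α → ℕ → Bool} (hP : Computable₂ P)
    (h : ∀ a, ∃ n, P a n = true) : ∃ f : α → ℕ, Computable f ∧ ∀ a, P a (f a) = true := by
  refine ⟨fun a => Nat.find (h a), ?_, fun a => Nat.find_spec (h a)⟩
  refine (Partrec.rfind hP.partrec₂).of_eq_tot fun a => ?_
  rw [Nat.mem_rfind]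
  refine ⟨by simpa using Nat.find_spec (h a), fun {m} hm => ?_⟩
  simpa using Nat.find_min (h a) hm

theorem computable_decide_eq [DecidableEq σ] {f g : α → σ} (hf : Computable f)
    (hg : Computable g) : Computable fun a => decide (f a = g a) :=
  (PrimrecRel.decide Primrec.eq).to_comp.comp hf hg

theorem primrec_decide_mem : Primrec₂ fun (n : ℕ) (l : List ℕ) => decide (n ∈ l) := by
  have h : PrimrecRel fun (l : List ℕ) (n : ℕ) => ∃ a ∈ l, a = n :=
    PrimrecRel.exists_mem_list Primrec.eq
  have h2 : PrimrecRel fun (n : ℕ) (l : List ℕ) => n ∈ l :=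
    PrimrecRel.of_eq (PrimrecRel.swap h) (by simp [Function.swap])
  exact PrimrecRel.decide h2

theorem computable_decide_mem {f : α → ℕ} {l : α → List ℕ} (hf : Computable f)
    (hl : Computable l) : Computable fun a => decide (f a ∈ l a) :=
  primrec_decide_mem.to_comp.comp hf hl

theorem computable_ite_eq {f g : α → ℕ} {u v : α → σ} (hf : Computable f) (hg : Computable g)
    (hu : Computable u) (hv : Computable v) : Computable fun a => if f a = g a then u a else v a :=
  (Computable.cond (computable_decide_eq hf hg) hu hv).of_eq fun a => by
    by_cases h : f a = g a <;> simp [h]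

theorem computable_fst {f : α → ℕ} (hf : Computable f) : Computable fun a => (f a).unpair.1 :=
  Computable.fst.comp (Computable.unpair.comp hf)

theorem computable_snd {f : α → ℕ} (hf : Computable f) : Computable fun a => (f a).unpair.2 :=
  Computable.snd.comp (Computable.unpair.comp hf)

theorem computable_pre {g : α → Baire} {f : α → ℕ} (hg : Computable₂ g) (hf : Computable f) :
    Computable fun a => Baire.pre (g a) (f a) :=
  computable_map_range hf hg

/-- A computable multi-valued operation can be applied along computable families of names. -/
theorem ComputableOp.exists_names {A B : Type*} {δ : Rep A} {δ' : Rep B} {dom : Set A}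
    {f : A → Set B} (hf : ComputableOp δ δ' dom f) {g : α → Baire} (hg : Computable₂ g)
    {x : α → A} (hx : ∀ a, δ (g a) (x a)) (hdom : ∀ a, x a ∈ dom) :
    ∃ (q : α → Baire) (y : α → B), Computable₂ q ∧ ∀ a, δ' (q a) (y a) ∧ y a ∈ f (x a) := by
  obtain ⟨φ, hφ, H⟩ := hf
  choose q y hq hy using fun a => H (g a) (x a) (hx a) (hdom a)
  refine ⟨q, y, ?_, hy⟩
  have hG : Computable₂ fun (a : α × ℕ) (k : ℕ) => φ (Baire.pre (g a.1) k) a.2 :=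
    hφ.comp (computable_pre
        (hg.comp (Computable.fst.comp (Computable.fst.comp Computable.fst)) Computable.snd)
        Computable.snd)
      (Computable.snd.comp Computable.fst)
  -- `Produces` requires silence on all shorter prefixes, so unbounded search halts at exactly the
  -- prefix that yields the digit.
  refine (Partrec.rfindOpt hG).of_eq_tot fun a => ?_
  obtain ⟨k, hk, hlt⟩ := hq a.1 a.2
  rw [Nat.rfindOpt, Part.mem_bind_iff]
  refine ⟨k, ?_, by simp [hk]⟩
  exact Nat.mem_rfind.2 ⟨by simp [hk], fun {m} hm => by simp [hlt m hm]⟩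

theorem ComputableMap.exists_names {A : Type*} {δ : Rep A} {b : ℕ → A}
    (hb : ComputableMap natRep δ b) :
    ∃ g : ℕ → Baire, Computable₂ g ∧ ∀ n, δ (g n) (b n) := by
  obtain ⟨q, y, hq, hy⟩ := ComputableOp.exists_names (α := ℕ) (g := fun n _ => n) hb
    Computable.fst (x := id) (fun _ => rfl) (fun _ => mem_univ _)
  refine ⟨q, hq, fun n => ?_⟩
  have := hy n
  rw [mem_singleton_iff] at this
  exact this.2 ▸ this.1

theorem computableMap_of_names {A : Type*} {δ : Rep A} {b : ℕ → A} {g : ℕ → Baire}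
    (hg : Computable₂ g) (h : ∀ n, δ (g n) (b n)) : ComputableMap natRep δ b := by
  -- One input digit determines the number, so the machine is silent only on the empty prefix.
  refine ⟨fun w n => w.head?.map fun a => g a n, ?_, ?_⟩
  · exact Computable.option_map (Primrec.list_head?.to_comp.comp Computable.fst)
      (hg.comp Computable.snd (Computable.snd.comp Computable.fst))
  · rintro p a rfl -
    refine ⟨g (p 0), b (p 0), fun n => ⟨1, by simp [Baire.pre], fun j hj => ?_⟩, h _, rfl⟩
    obtain rfl : j = 0 := by omega
    rfl

end Computability

/-! ### Finite stages of names of open sets -/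

/-- The indices of the ideal balls listed in a finite piece of a name of an open set. -/
def coverWord (l : List ℕ) : List ℕ := l.filterMap Nat.ppred

theorem mem_coverWord {l : List ℕ} {a : ℕ} : a ∈ coverWord l ↔ a + 1 ∈ l := by
  simp [coverWord, eq_comm]

theorem primrec_coverWord : Primrec coverWord := by
  have h : Primrec Nat.ppred := by
    refine (Primrec.nat_casesOn₁ (none : Option ℕ) Primrec.option_some).of_eq fun n => ?_
    cases n <;> rfl
  exact Primrec.listFilterMap Primrec.id (h.comp Primrec.snd).to₂

theorem mem_pre {p : Baire} {k a : ℕ} : a ∈ p.pre k ↔ ∃ i < k, p i = a := by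
  simp [Baire.pre]

section

variable {α : Type*} [Primcodable α]

theorem computable_coverWord_pre {q : α → Baire} {s : α → ℕ} (hq : Computable₂ q)
    (hs : Computable s) : Computable fun a => Encodable.encode (coverWord ((q a).pre (s a))) :=
  Computable.encode.comp (primrec_coverWord.to_comp.comp (computable_pre hq hs))

/-- If `κ` names the compact set `K`, then `relName κ q` names `K \ openSet q`. -/
def relName (κ q : Baire) : Baire := fun z =>
  if κ z.unpair.2.unpair.2 =
      Encodable.encode
        (Denumerable.ofNat (List ℕ) z.unpair.1 ++ coverWord (q.pre z.unpair.2.unpair.1))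
  then z.unpair.1 else κ 0

theorem computable_relName {κ q : α → Baire} (hκ : Computable₂ κ) (hq : Computable₂ q) :
    Computable₂ fun a => relName (κ a) (q a) := by
  have z1 : Computable fun a : α × ℕ => a.2.unpair.1 := computable_fst Computable.snd
  have z2 : Computable fun a : α × ℕ => a.2.unpair.2 := computable_snd Computable.snd
  have hq' : Computable₂ fun a : α × ℕ => q a.1 :=
    hq.comp (Computable.fst.comp Computable.fst) Computable.snd
  exact computable_ite_eq (hκ.comp Computable.fst (computable_snd z2))
    (Computable.encode.comp (Computable.list_append.comp
      ((Computable.ofNat (List ℕ)).comp z1)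
      (primrec_coverWord.to_comp.comp (computable_pre hq' (computable_fst z2)))))
    z1 (hκ.comp Computable.fst (Computable.const 0))

end

/-! ### Ideal covers, names of compact sets, and named sequences of compact open sets -/

section

variable {X : Type*} [ComputableMetricSpace X]

theorem mem_idealCover {w : List ℕ} {x : X} :
    x ∈ idealCover X w ↔ ∃ a ∈ w, x ∈ idealBall X a := by
  simp [idealCover]

theorem mem_openSet {q : Baire} {x : X} :
    x ∈ openSet X q ↔ ∃ i a, q i = a + 1 ∧ x ∈ idealBall X a := by
  simp only [openSet, mem_iUnion, exists_prop]
  constructor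
  · rintro ⟨i, hi, hx⟩
    exact ⟨i, q i - 1, by omega, hx⟩
  · rintro ⟨i, a, hi, hx⟩
    exact ⟨i, by omega, by simpa [hi] using hx⟩

theorem isOpen_idealBall (a : ℕ) : IsOpen (idealBall X a) := Metric.isOpen_ball

theorem radius_pos (a : ℕ) : 0 < radius a := by
  have : 0 < posRat a.unpair.2 := by unfold posRat; positivity
  exact Rat.cast_pos.2 this

theorem center_mem (a : ℕ) : center X a ∈ idealBall X a := Metric.mem_ball_self (radius_pos a)

theorem isOpen_idealCover (w : List ℕ) : IsOpen (idealCover X w) :=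
  isOpen_biUnion fun a _ => isOpen_idealBall a

theorem idealCover_append (u v : List ℕ) :
    idealCover X (u ++ v) = idealCover X u ∪ idealCover X v := by
  ext x; simp only [mem_idealCover, mem_union, List.mem_append]; grind

theorem idealCover_coverWord_subset (q : Baire) (s : ℕ) :
    idealCover X (coverWord (q.pre s)) ⊆ openSet X q := by
  intro x hx
  simp only [mem_idealCover, mem_coverWord, mem_pre] at hx
  obtain ⟨a, ⟨i, -, hi⟩, hx⟩ := hx
  exact mem_openSet.2 ⟨i, a, hi, hx⟩

theorem monotone_idealCover_coverWord (q : Baire) :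
    Monotone fun s => idealCover X (coverWord (q.pre s)) := by
  intro s t hst x hx
  simp only [mem_idealCover, mem_coverWord, mem_pre] at hx ⊢
  obtain ⟨a, ⟨i, hs, hi⟩, hx⟩ := hx
  exact ⟨a, ⟨i, hs.trans_le hst, hi⟩, hx⟩

theorem openSet_eq_iUnion (q : Baire) :
    openSet X q = ⋃ s, idealCover X (coverWord (q.pre s)) := by
  refine Subset.antisymm (fun x hx => ?_) (iUnion_subset fun s => idealCover_coverWord_subset q s)
  obtain ⟨i, a, hi, hx⟩ := mem_openSet.1 hx
  exact mem_iUnion.2 ⟨i + 1, mem_idealCover.2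
    ⟨a, mem_coverWord.2 (mem_pre.2 ⟨i, by omega, hi⟩), hx⟩⟩

/-- The finite stages of `q` form an increasing open cover, so compactness selects a single one. -/
theorem exists_subset_coverWord {K : Set X} (hK : IsCompact K) {w : List ℕ} {q : Baire}
    (h : K ⊆ idealCover X w ∪ openSet X q) :
    ∃ s, K ⊆ idealCover X (w ++ coverWord (q.pre s)) := by
  refine hK.elim_directed_cover (fun s => idealCover X (w ++ coverWord (q.pre s)))
    (fun s => isOpen_idealCover _) ?_ ?_
  · simpa only [idealCover_append, openSet_eq_iUnion, union_iUnion] using h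
  · simp only [idealCover_append]
    exact Monotone.directed_le fun s t hst =>
      union_subset_union_right _ (monotone_idealCover_coverWord q hst)

theorem compactRep_spec {κ : Baire} {K : Compacts X} (h : compactRep X κ K) (w : List ℕ) :
    (∃ t, κ t = Encodable.encode w) ↔ (K : Set X) ⊆ idealCover X w := by
  rw [compactRep] at h
  have := congrArg (Encodable.encode w ∈ ·) h
  simp only [mem_range, mem_ofPred_eq, eq_iff_iff] at this
  rw [this]
  constructor
  · rintro ⟨w', hw', e⟩
    rwa [Encodable.encode_injective e]
  · exact fun h => ⟨w, h, rfl⟩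

theorem compactRep_of_spec {κ : Baire} {K : Compacts X}
    (h : ∀ w : List ℕ, (∃ t, κ t = Encodable.encode w) ↔ (K : Set X) ⊆ idealCover X w) :
    compactRep X κ K := by
  ext a
  obtain ⟨w, rfl⟩ : ∃ w : List ℕ, Encodable.encode w = a :=
    ⟨Denumerable.ofNat _ a, Denumerable.encode_ofNat a⟩
  simp only [mem_range, mem_ofPred_eq, h]
  constructor
  · exact fun h => ⟨w, h, rfl⟩
  · rintro ⟨w', hw', e⟩
    rwa [Encodable.encode_injective e]

/-- This turns inclusion of a compact set in an open set into a search for two numbers; every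
confirmation of an inclusion in an open set given by a name rests on it. -/
theorem compactRep_subset_openSet {κ : Baire} {K : Compacts X} (h : compactRep X κ K) (q : Baire) :
    (∃ s t, κ t = Encodable.encode (coverWord (q.pre s))) ↔ (K : Set X) ⊆ openSet X q := by
  simp only [compactRep_spec h]
  constructor
  · rintro ⟨s, hs⟩
    exact hs.trans (idealCover_coverWord_subset q s)
  · intro hK
    simpa using exists_subset_coverWord K.isCompact (w := []) (hK.trans subset_union_right)

/-- A word `w` covers `K \ openSet q` iff `w` together with `openSet q` covers `K`, and by
compactness iff `w` with some finite stage of `q` does. -/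
theorem compactRep_relName {κ q : Baire} {K L : Compacts X} (hκ : compactRep X κ K)
    (hL : (L : Set X) = (K : Set X) \ openSet X q) : compactRep X (relName κ q) L := by
  refine compactRep_of_spec fun w => ?_
  rw [hL]
  constructor
  · rintro ⟨z, hz⟩
    unfold relName at hz
    split_ifs at hz with h
    · rw [hz, Denumerable.ofNat_encode] at h
      have := (compactRep_spec hκ _).1 ⟨_, h⟩
      rw [idealCover_append] at this
      rintro x ⟨hxK, hxq⟩
      exact (this hxK).resolve_right fun h => hxq (idealCover_coverWord_subset _ _ h)
    -- The default entry `κ 0` codes a cover of all of `K`, so it is harmless for the smaller set.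
    · exact sdiff_subset.trans ((compactRep_spec hκ _).1 ⟨_, hz⟩)
  · intro h
    have : (K : Set X) ⊆ idealCover X w ∪ openSet X q := by
      rw [union_comm]; exact sdiff_subset_iff.1 h
    obtain ⟨s, hs⟩ := exists_subset_coverWord K.isCompact this
    obtain ⟨t, ht⟩ := (compactRep_spec hκ _).2 hs
    refine ⟨Nat.pair (Encodable.encode w) (Nat.pair s t), ?_⟩
    unfold relName
    simp only [Nat.unpair_pair, Denumerable.ofNat_encode]
    rw [if_pos ht]

/-- Names of a sequence of compact open sets. -/
structure CompactOpenNames (b : ℕ → CompactOpens X) (O N κ : ℕ → Baire) : Prop where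
  computable_O : Computable₂ O
  computable_N : Computable₂ N
  computable_κ : Computable₂ κ
  openSet_O : ∀ n, openSet X (O n) = b n
  openSet_N : ∀ n, openSet X (N n) = (b n : Set X)ᶜ
  compactRep_κ : ∀ n, compactRep X (κ n) (b n).toCompacts

/-- Binary tupling on Baire space. -/
def tuple (p q : Baire) : Baire := fun n => if n % 2 = 0 then p (n / 2) else q (n / 2)

@[simp] theorem tuple_fst (p q : Baire) : (tuple p q).fst = p := by
  ext n; simp [tuple, Baire.fst]

@[simp] theorem tuple_snd (p q : Baire) : (tuple p q).snd = q := by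
  ext n
  have h1 : (2 * n + 1) % 2 ≠ 0 := by omega
  have h2 : (2 * n + 1) / 2 = n := by omega
  simp [tuple, Baire.snd, h2]

theorem computable_tuple {α : Type*} [Primcodable α] {p q : α → Baire} (hp : Computable₂ p)
    (hq : Computable₂ q) : Computable₂ fun a => tuple (p a) (q a) := by
  have h2 : Computable fun a : α × ℕ => a.2 / 2 :=
    Primrec.nat_div.to_comp.comp Computable.snd (Computable.const 2)
  exact computable_ite_eq
    (Primrec.nat_mod.to_comp.comp Computable.snd (Computable.const 2)) (Computable.const 0)
    (hp.comp Computable.fst h2) (hq.comp Computable.fst h2)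

theorem computable_baire_fst {α : Type*} [Primcodable α] {p : α → Baire} (hp : Computable₂ p) :
    Computable₂ fun a => (p a).fst :=
  hp.comp Computable.fst (Primrec.nat_double.to_comp.comp Computable.snd)

theorem computable_baire_snd {α : Type*} [Primcodable α] {p : α → Baire} (hp : Computable₂ p) :
    Computable₂ fun a => (p a).snd :=
  hp.comp Computable.fst (Primrec.nat_double_succ.to_comp.comp Computable.snd)

theorem CompactOpenNames.computableMap {b : ℕ → CompactOpens X} {O N κ : ℕ → Baire}
    (h : CompactOpenNames b O N κ) : ComputableMap natRep (compactOpenRep X) b := by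
  refine computableMap_of_names (g := fun n => tuple (tuple (O n) (N n)) (κ n))
    (computable_tuple (computable_tuple h.computable_O h.computable_N) h.computable_κ) fun n => ?_
  simp [compactOpenRep, clopenRep, h.openSet_O, h.openSet_N, h.compactRep_κ]

theorem exists_compactOpenNames {b : ℕ → CompactOpens X}
    (h : ComputableMap natRep (compactOpenRep X) b) :
    ∃ O N κ, CompactOpenNames b O N κ := by
  obtain ⟨g, hg, H⟩ := h.exists_names
  refine ⟨fun n => (g n).fst.fst, fun n => (g n).fst.snd, fun n => (g n).snd,
    computable_baire_fst (computable_baire_fst hg), computable_baire_snd (computable_baire_fst hg),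
    computable_baire_snd hg, fun n => (H n).1.1, fun n => ?_, fun n => (H n).2⟩
  rw [← compl_compl (openSet X _), (H n).1.2]
  rfl

theorem hasComputableCompactOpenBasis_of_names {b : ℕ → CompactOpens X} {O N κ : ℕ → Baire}
    (h : CompactOpenNames b O N κ)
    (hb : ∀ (x : X) (U : Set X), IsOpen U → x ∈ U → ∃ n, x ∈ b n ∧ (b n : Set X) ⊆ U) :
    HasComputableCompactOpenBasis X := by
  refine ⟨_, b, ?_, h.computableMap, rfl⟩
  refine isTopologicalBasis_of_isOpen_of_nhds ?_ ?_
  · rintro _ ⟨n, rfl⟩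
    exact (b n).isOpen
  · intro x U hx hU
    obtain ⟨n, h1, h2⟩ := hb x U hU hx
    exact ⟨_, ⟨n, rfl⟩, h1, h2⟩

theorem exists_basis_mem {b : ℕ → CompactOpens X}
    (hb : IsTopologicalBasis (range fun n => (b n : Set X))) (x : X) (U : Set X) (hU : IsOpen U)
    (hx : x ∈ U) : ∃ n, x ∈ b n ∧ (b n : Set X) ⊆ U := by
  obtain ⟨_, ⟨n, rfl⟩, h1, h2⟩ := hb.exists_subset_of_mem_open hx hU
  exact ⟨n, h1, h2⟩

end

/-! ### Refined inclusions, and compact open bases from decompositions -/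

theorem rePred_exists {α : Type*} [Primcodable α] {P : α → ℕ → Bool} (hP : Computable₂ P) :
    REPred fun a => ∃ n, P a n = true :=
  (Partrec.rfind hP.partrec₂).dom_re.of_eq fun a => by
    rw [Nat.rfind_dom]
    simp

variable {X : Type*} [ComputableMetricSpace X]

theorem idealCover_singleton (a : ℕ) : idealCover X [a] = idealBall X a := by
  ext x; simp [mem_idealCover]

/-- The relation holds when the compact name of `b c` lists the one-letter word `[d]`. This is
equivalent to true inclusion, so the refinement property is just the basis property. -/
theorem HasComputableCompactOpenBasis.hasComputableClopenBasis
    (h : HasComputableCompactOpenBasis X) : HasComputableClopenBasis X := by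
  obtain ⟨𝓑, b, hb, hmap, rfl⟩ := h
  obtain ⟨O, N, κ, hn⟩ := exists_compactOpenNames hmap
  have hsub : ∀ c d, (∃ t, κ c t = Encodable.encode [d]) ↔ (b c : Set X) ⊆ idealBall X d := by
    intro c d
    rw [← idealCover_singleton]
    exact compactRep_spec (hn.compactRep_κ c) [d]
  refine ⟨fun n => (b n).toClopens, fun x => ∃ t, decide (κ x.1 t = Encodable.encode [x.2]) = true,
    ?_, ?_, ⟨?_, ?_⟩, hb⟩
  · refine computableMap_of_names (g := fun n => tuple (O n) (N n))
      (computable_tuple hn.computable_O hn.computable_N) fun n => ?_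
    simp [clopenRep, hn.openSet_O, hn.openSet_N]
  · exact rePred_exists (computable_decide_eq
      (hn.computable_κ.comp (Computable.fst.comp Computable.fst) Computable.snd)
      (Computable.encode.comp (Computable.list_cons.comp (Computable.snd.comp Computable.fst)
        (Computable.const []))))
  · intro c d h
    simp only [decide_eq_true_eq] at h
    exact (hsub c d).1 h
  · intro d x hx
    obtain ⟨n, h1, h2⟩ := exists_basis_mem hb x _ (isOpen_idealBall d) hx
    refine ⟨n, h1, ?_⟩
    simp only [decide_eq_true_eq]
    exact (hsub n d).2 h2

theorem computable_component {α : Type*} [Primcodable α] {p : α → Baire} {i : α → ℕ}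
    (hp : Computable₂ p) (hi : Computable i) : Computable₂ fun a => (p a).component (i a) :=
  hp.comp Computable.fst
    (Primrec₂.natPair.to_comp.comp (hi.comp Computable.fst) Computable.snd)

/-- The new basis consists of all pieces of all decompositions. A piece of `U_a` is closed in `K_a`,
hence compact, and it equals `K_a` minus its named open complement, which gives its compact name. -/
theorem HasComputableBasisWithCompactSupersets.hasComputableCompactOpenBasis
    (h : HasComputableBasisWithCompactSupersets X) (hD : DecompositionComputable X) :
    HasComputableCompactOpenBasis X := by
  obtain ⟨γ, hmap, hbasis, hsub⟩ := h
  obtain ⟨g, hg, hγ⟩ := hmap.exists_names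
  obtain ⟨q, y, hq, hy⟩ := ComputableOp.exists_names hD hg hγ hsub
  have hunion : ∀ a, ⋃ i, ((y a).1.1 i : Set X) = ((γ a).1 : Set X) := by
    intro a
    obtain ⟨W, r, s, e, -, hU, -⟩ := (hy a).2
    rw [e]
    exact hU
  have hWK : ∀ a i, ((y a).1.1 i : Set X) ⊆ ((γ a).2 : Set X) := fun a i =>
    (subset_iUnion (fun i => ((y a).1.1 i : Set X)) i).trans ((hunion a).subset.trans (hsub a))
  let b : ℕ → CompactOpens X := fun n =>
    ⟨⟨(y n.unpair.1).1.1 n.unpair.2, (γ n.unpair.1).2.isCompact.of_isClosed_subset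
      ((y n.unpair.1).1.1 n.unpair.2).isClopen.1 (hWK _ _)⟩,
      ((y n.unpair.1).1.1 n.unpair.2).isClopen.2⟩
  have hrep : ∀ n : ℕ, clopenRep X ((q n.unpair.1).fst.fst.component n.unpair.2)
      ((y n.unpair.1).1.1 n.unpair.2) := fun n => (hy n.unpair.1).1.1.1 n.unpair.2
  have e1 : Computable fun n : ℕ => n.unpair.1 := computable_fst Computable.id
  have hc : Computable₂ fun n : ℕ => (q n.unpair.1).fst.fst.component n.unpair.2 :=
    computable_component (computable_baire_fst (computable_baire_fst
      (hq.comp (e1.comp Computable.fst) Computable.snd))) (computable_snd Computable.id)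
  have hN : ∀ n : ℕ, openSet X ((q n.unpair.1).fst.fst.component n.unpair.2).snd =
      (b n : Set X)ᶜ := fun n => by
    rw [← compl_compl (openSet X _), (hrep n).2]
    rfl
  refine hasComputableCompactOpenBasis_of_names (b := b)
    (O := fun n => ((q n.unpair.1).fst.fst.component n.unpair.2).fst)
    (N := fun n => ((q n.unpair.1).fst.fst.component n.unpair.2).snd)
    (κ := fun n => relName (g n.unpair.1).snd ((q n.unpair.1).fst.fst.component n.unpair.2).snd)
    ⟨computable_baire_fst hc, computable_baire_snd hc,
      computable_relName (computable_baire_snd (hg.comp (e1.comp Computable.fst) Computable.snd))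
        (computable_baire_snd hc), fun n => (hrep n).1, hN, fun n => ?_⟩ ?_
  · refine compactRep_relName (hγ n.unpair.1).2 ?_
    rw [hN, sdiff_compl]
    exact (inter_eq_right.2 (hWK _ _)).symm
  · intro x U hU hx
    obtain ⟨_, ⟨a, rfl⟩, h1, h2⟩ := hbasis.exists_subset_of_mem_open hx hU
    have h1' := h1
    simp only [← hunion a, mem_iUnion] at h1'
    obtain ⟨i, hi⟩ := h1'
    refine ⟨Nat.pair a i, ?_, ?_⟩
    · change x ∈ (b (Nat.pair a i) : Set X)
      simpa [b] using hi
    · have : (b (Nat.pair a i) : Set X) = ((y a).1.1 i : Set X) := by simp [b]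
      rw [this]
      exact ((subset_iUnion (fun i => ((y a).1.1 i : Set X)) i).trans (hunion a).subset).trans h2

/-! ### Compact spaces of dimension zero -/

/-- Refine the cover by `U` and the complement of `{x}`. Order one means that distinct members are
disjoint, so each member is clopen, and the one containing `x` can only refine `U`. -/
theorem exists_isClopen_of_coveringDimLE {K : Compacts X} (hK : (K : Set X) = univ)
    (hdim : CoveringDimLE (K : Set X) 0) {U : Set X} (hU : IsOpen U) {x : X} (hx : x ∈ U) :
    ∃ C : Set X, IsClopen C ∧ x ∈ C ∧ C ⊆ U := by
  have hKo : IsOpen (K : Set X) := hK ▸ isOpen_univ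
  have hmem : ∀ y, y ∈ (K : Set X) := fun y => hK ▸ mem_univ y
  obtain ⟨m, V, hVo, hVu, hVr, hV⟩ := hdim 2 ![Subtype.val ⁻¹' U, Subtype.val ⁻¹' {x}ᶜ]
    (by
      intro i
      fin_cases i
      · exact hU.preimage continuous_subtype_val
      · exact isOpen_compl_singleton.preimage continuous_subtype_val)
    (by
      ext y
      simp only [mem_iUnion, Fin.exists_fin_two, mem_univ, iff_true]
      by_cases h : (y : X) = x
      · exact Or.inl (by simpa [h] using hx)
      · exact Or.inr (by simpa using h))
  obtain ⟨j, hj⟩ := mem_iUnion.1 (hVu.symm ▸ mem_univ (⟨x, hmem x⟩ : (K : Set X)))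
  have hdisj : ∀ i, i ≠ j → Disjoint (V i) (V j) := by
    intro i hij
    have := hV ![i, j] (by
      intro a c hac
      fin_cases a <;> fin_cases c <;> simp_all)
    rw [disjoint_iff_inter_eq_empty, ← this]
    ext y
    simp [Fin.forall_fin_two]
  refine ⟨Subtype.val '' V j, ⟨⟨?_⟩, hKo.isOpenMap_subtype_val _ (hVo j)⟩, ⟨_, hj, rfl⟩, ?_⟩
  · have : (Subtype.val '' V j)ᶜ = Subtype.val '' (⋃ (i) (_ : i ≠ j), V i) := by
      ext y
      constructor
      · intro hy
        obtain ⟨i, hi⟩ := mem_iUnion.1 (hVu.symm ▸ mem_univ (⟨y, hmem y⟩ : (K : Set X)))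
        refine ⟨⟨y, hmem y⟩, mem_iUnion₂.2 ⟨i, ?_, hi⟩, rfl⟩
        rintro rfl
        exact hy ⟨_, hi, rfl⟩
      · rintro ⟨z, hz, rfl⟩ ⟨z', hz', e⟩
        obtain rfl := Subtype.ext e
        obtain ⟨i, hi, hz⟩ := mem_iUnion₂.1 hz
        exact disjoint_left.1 (hdisj i hi) hz hz'
    rw [this]
    exact hKo.isOpenMap_subtype_val _ (isOpen_iUnion fun i => isOpen_iUnion fun _ => hVo i)
  · obtain ⟨i, hi⟩ := hVr j
    rintro _ ⟨y, hy, rfl⟩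
    fin_cases i
    · exact hi hy
    · exact absurd rfl (hi hj)

/-- By density, the balls of this radius around those `ν i` that lie in `D` already cover `D`;
compactness leaves finitely many. -/
theorem exists_word_of_isOpen_isCompact {D : Set X} (hDo : IsOpen D) (hDc : IsCompact D) (m : ℕ) :
    ∃ u : List ℕ, D ⊆ idealCover X u ∧
      ∀ a ∈ u, center X a ∈ D ∧ radius a = 1 / ((m : ℝ) + 1) := by
  classical
  -- `Nat.pair 0 m` is an index of the rational `1 / (m + 1)`.
  have hrad : ∀ i, radius (Nat.pair i (Nat.pair 0 m)) = 1 / ((m : ℝ) + 1) := by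
    intro i; simp [radius, posRat]
  let q : Baire := fun i =>
    if center X (Nat.pair i (Nat.pair 0 m)) ∈ D then Nat.pair i (Nat.pair 0 m) + 1 else 0
  have hq : D ⊆ openSet X q := by
    intro x hx
    obtain ⟨i, h1, h2⟩ := ComputableMetricSpace.dense_ν.exists_mem_open
      (hDo.inter (Metric.isOpen_ball (x := x) (ε := 1 / ((m : ℝ) + 1))))
      ⟨x, hx, Metric.mem_ball_self (by positivity)⟩
    have hc : center X (Nat.pair i (Nat.pair 0 m)) = ComputableMetricSpace.ν i := by simp [center]
    refine mem_openSet.2 ⟨i, Nat.pair i (Nat.pair 0 m), if_pos (hc ▸ h1), ?_⟩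
    rw [idealBall, hrad, hc, Metric.mem_ball']
    exact h2
  obtain ⟨s, hs⟩ := exists_subset_coverWord hDc (w := []) (hq.trans subset_union_right)
  refine ⟨_, hs, fun a ha => ?_⟩
  rw [List.nil_append, mem_coverWord, mem_pre] at ha
  obtain ⟨i, -, hi⟩ := ha
  by_cases h : center X (Nat.pair i (Nat.pair 0 m)) ∈ D
  · simp only [q, if_pos h, Nat.add_right_cancel_iff] at hi
    subst hi
    exact ⟨h, hrad i⟩
  · simp [q, if_neg h] at hi

/-- A compact open `C` contains its own `δ`-thickening for some `δ > 0`. Cover `C` and its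
complement by balls centred in them with radius below `δ / 2`: centres on different sides are at
least `δ` apart, and balls centred in `C` stay in `C`. -/
theorem exists_formallyDisjoint_of_isClopen (hX : IsCompact (univ : Set X)) {C : Set X}
    (hC : IsClopen C) : ∃ u v : List ℕ, FormallyDisjoint X u v ∧
      idealCover X u = C ∧ C ∪ idealCover X v = univ := by
  have hCc : IsCompact C := hX.of_isClosed_subset hC.1 (subset_univ _)
  obtain ⟨δ, hδ, hthick⟩ := hCc.exists_thickening_subset_open hC.2 Subset.rfl
  have hsep : ∀ x ∈ C, ∀ y, dist y x < δ → y ∈ C := fun x hx y hxy =>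
    hthick (Metric.mem_thickening_iff.2 ⟨x, hx, hxy⟩)
  obtain ⟨m, hm⟩ := exists_nat_one_div_lt (half_pos hδ)
  obtain ⟨u, hu, hu'⟩ := exists_word_of_isOpen_isCompact hC.2 hCc m
  obtain ⟨v, hv, hv'⟩ := exists_word_of_isOpen_isCompact hC.compl.2
    (hX.of_isClosed_subset hC.compl.1 (subset_univ _)) m
  refine ⟨u, v, fun a ha b hb => ?_, Subset.antisymm (fun x hx => ?_) hu,
    eq_univ_of_forall fun x => ?_⟩
  · rw [(hu' a ha).2, (hv' b hb).2]
    by_contra hlt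
    refine (hv' b hb).1 (hsep _ (hu' a ha).1 _ ?_)
    rw [dist_comm]
    linarith
  · obtain ⟨a, ha, hx⟩ := mem_idealCover.1 hx
    refine hsep _ (hu' a ha).1 _ ?_
    rw [idealBall, (hu' a ha).2, Metric.mem_ball] at hx
    linarith
  · by_cases h : x ∈ C
    · exact Or.inl h
    · exact Or.inr (hv h)

theorem FormallyDisjoint.disjoint {u v : List ℕ} (h : FormallyDisjoint X u v) :
    Disjoint (idealCover X u) (idealCover X v) := by
  rw [disjoint_left]
  intro x hu hv
  obtain ⟨a, ha, hxa⟩ := mem_idealCover.1 hu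
  obtain ⟨b, hb, hxb⟩ := mem_idealCover.1 hv
  exact disjoint_left.1 (Metric.ball_disjoint_ball (h a ha b hb).le) hxa hxb

theorem idealCover_flatten (ws : List (List ℕ)) :
    idealCover X ws.flatten = ⋃ w ∈ ws, idealCover X w := by
  ext x
  simp only [mem_idealCover, List.mem_flatten, mem_iUnion, exists_prop]
  grind

theorem idealCover_erase_eq_compl {ws : List (List ℕ)} (hcov : ⋃ w ∈ ws, idealCover X w = univ)
    (hd : ws.Pairwise (FormallyDisjoint X)) (j : ℕ) :
    idealCover X (ws.take j ++ ws.drop (j + 1)).flatten = (idealCover X (ws.getD j []))ᶜ := by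
  by_cases hj : j < ws.length
  · have hws : ws = ws.take j ++ ws[j] :: ws.drop (j + 1) := by simp
    have hget : ws.getD j [] = ws[j] := by simp [hj]
    rw [hget]
    generalize ws.take j = l₁ at *
    generalize ws.drop (j + 1) = l₂ at *
    generalize ws[j] = w at *
    subst hws
    rw [List.pairwise_append, List.pairwise_cons] at hd
    obtain ⟨-, ⟨h1, -⟩, h2⟩ := hd
    rw [idealCover_flatten]
    refine (IsCompl.compl_eq (isCompl_iff.2 ⟨?_, ?_⟩)).symm
    · simp only [disjoint_iUnion_right]
      intro v hv
      rcases List.mem_append.1 hv with hv | hv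
      · exact (h2 v hv w (by simp)).disjoint.symm
      · exact (h1 v hv).disjoint
    · refine codisjoint_iff.2 (eq_univ_of_forall ?_)
      intro x
      obtain ⟨v, hv, hx⟩ := mem_iUnion₂.1 (hcov.symm ▸ mem_univ x)
      simp only [List.mem_append, List.mem_cons] at hv
      rcases hv with hv | rfl | hv
      · exact Or.inr (mem_iUnion₂.2 ⟨v, List.mem_append_left _ hv, hx⟩)
      · exact Or.inl hx
      · exact Or.inr (mem_iUnion₂.2 ⟨v, List.mem_append_right _ hv, hx⟩)
  -- Past the end the selected word is empty and nothing is removed, so the identity reads `univ =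
  -- ∅ᶜ`. Hence every pair of indices is usable later, without a range check.
  · push Not at hj
    rw [List.take_of_length_le hj, List.drop_eq_nil_of_le (by omega), List.append_nil,
      idealCover_flatten, hcov]
    simp [hj, idealCover]

/-! ### Words and coded tuples of words as names; the basis from a `δ_dc`-name -/

/-- A name of an ideal cover as an open set. -/
def wordName (w : List ℕ) : Baire := fun x => (w.map Nat.succ).getD x 0

theorem openSet_wordName (w : List ℕ) : openSet X (wordName w) = idealCover X w := by
  ext x
  rw [mem_openSet, mem_idealCover]
  constructor
  · rintro ⟨i, a, h, hx⟩
    refine ⟨a, ?_, hx⟩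
    unfold wordName at h
    by_cases hi : i < w.length
    · simp only [List.getD_eq_getElem?_getD, List.getElem?_map, List.getElem?_eq_getElem hi] at h
      simp at h
      exact h ▸ List.getElem_mem hi
    · simp [not_lt.1 hi] at h
  · rintro ⟨a, ha, hx⟩
    obtain ⟨i, hi, rfl⟩ := List.getElem_of_mem ha
    exact ⟨i, w[i], by simp [wordName, hi], hx⟩

theorem computable_wordName {α : Type*} [Primcodable α] {w : α → List ℕ} (hw : Computable w) :
    Computable₂ fun a => wordName (w a) := by
  have h : Primrec fun l : List ℕ => l.map Nat.succ :=
    Primrec.list_map Primrec.id (Primrec.succ.comp Primrec.snd).to₂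
  exact (Primrec.list_getD 0).to_comp.comp (h.to_comp.comp (hw.comp Computable.fst)) Computable.snd

/-- The word at position `j` in the tuple of words coded by `a`. -/
def tupleWord (a j : ℕ) : List ℕ :=
  Denumerable.ofNat (List ℕ) ((Denumerable.ofNat (List ℕ) a).getD j 0)

/-- The concatenation of all words except the one at position `j` in the tuple of words
coded by `a`. -/
def tupleRest (a j : ℕ) : List ℕ :=
  (((Denumerable.ofNat (List ℕ) a).take j ++ (Denumerable.ofNat (List ℕ) a).drop (j + 1)).map
    (Denumerable.ofNat (List ℕ))).flatten

theorem ofNat_comp_encode_words (ws : List (List ℕ)) :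
    (ws.map Encodable.encode).map (Denumerable.ofNat (List ℕ)) = ws := by
  simp [Function.comp_def]

theorem tupleWord_encode (ws : List (List ℕ)) (j : ℕ) :
    tupleWord (Encodable.encode (ws.map Encodable.encode)) j = ws.getD j [] := by
  unfold tupleWord
  rw [Denumerable.ofNat_encode]
  by_cases hj : j < ws.length
  · simp [hj]
  -- The default code `0` decodes to the empty word.
  · simp [not_lt.1 hj]

theorem tupleRest_encode (ws : List (List ℕ)) (j : ℕ) :
    tupleRest (Encodable.encode (ws.map Encodable.encode)) j =
      (ws.take j ++ ws.drop (j + 1)).flatten := by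
  unfold tupleRest
  rw [Denumerable.ofNat_encode, List.map_append, List.map_take, List.map_drop,
    ofNat_comp_encode_words]

theorem primrec_tupleWord : Primrec₂ tupleWord :=
  (Primrec.ofNat (List ℕ)).comp ((Primrec.list_getD 0).comp
    ((Primrec.ofNat (List ℕ)).comp Primrec.fst) Primrec.snd)

theorem primrec_tupleRest : Primrec₂ tupleRest := by
  have h : Primrec fun p : ℕ × ℕ => Denumerable.ofNat (List ℕ) p.1 :=
    (Primrec.ofNat (List ℕ)).comp Primrec.fst
  exact Primrec.list_flatten.comp (Primrec.list_map
    (Primrec.list_append.comp (Primrec.list_take.comp Primrec.snd h)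
      (Primrec.list_drop.comp (Primrec.succ.comp Primrec.snd) h))
    ((Primrec.ofNat (List ℕ)).comp Primrec.snd).to₂)

/-- One-word tuples yield a compact name of the whole space; the remaining words of a tuple name the
complement of the selected one, and subtracting them yields its compact name. -/
theorem DcComputable.hasComputableCompactOpenBasis (h : DcComputable X) :
    HasComputableCompactOpenBasis X := by
  obtain ⟨⟨K, hdim⟩, hK, p, hp, hname⟩ := h
  simp only at hK
  have hX : IsCompact (univ : Set X) := hK ▸ K.isCompact
  have hname : ∀ a, (∃ i, p i = a + 1) ↔ ∃ ws : List (List ℕ),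
      ⋃ w ∈ ws, idealCover X w = univ ∧ ws.Pairwise (FormallyDisjoint X) ∧
      a = Encodable.encode (ws.map Encodable.encode) := by
    intro a
    have := congrArg (a ∈ ·) hname
    simp only [hK, univ_subset_iff, mem_ofPred_eq, eq_iff_iff] at this
    exact this.symm
  -- A cover of the space by a single word gives an unpadded enumeration.
  have hcover : ∃ w : List ℕ, idealCover X w = univ := by
    obtain ⟨u, v, -, hu, hv⟩ := exists_formallyDisjoint_of_isClopen hX (C := univ) isClopen_univ
    exact ⟨u, hu⟩
  obtain ⟨w₀, hw₀⟩ := hcover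
  obtain ⟨i₀, hi₀⟩ := (hname _).2 ⟨[w₀], by simpa using hw₀, by simp, rfl⟩
  let e : ℕ → ℕ := fun i => if p i = 0 then p i₀ - 1 else p i - 1
  have he : Computable e := computable_ite_eq hp (Computable.const 0)
    (Computable.const _) (Computable.pred.comp hp)
  have hvalid : ∀ i, ∃ ws : List (List ℕ),
      ⋃ w ∈ ws, idealCover X w = univ ∧ ws.Pairwise (FormallyDisjoint X) ∧
      e i = Encodable.encode (ws.map Encodable.encode) := by
    intro i
    refine (hname _).1 ?_
    by_cases h : p i = 0
    · exact ⟨i₀, by simp [e, h, hi₀]⟩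
    · exact ⟨i, by simp only [e, if_neg h]; omega⟩
  have hsurj : ∀ ws : List (List ℕ), ⋃ w ∈ ws, idealCover X w = univ →
      ws.Pairwise (FormallyDisjoint X) →
      ∃ i, e i = Encodable.encode (ws.map Encodable.encode) := by
    intro ws h1 h2
    obtain ⟨i, hi⟩ := (hname _).2 ⟨ws, h1, h2, rfl⟩
    exact ⟨i, by simp [e, hi]⟩
  -- A name of the whole space as a compact set.
  let κ : Baire := fun z =>
    if e z.unpair.2 =
        Encodable.encode ([Denumerable.ofNat (List ℕ) z.unpair.1].map Encodable.encode)
    then z.unpair.1 else Encodable.encode w₀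
  have hκc : Computable κ := by
    have z1 : Computable fun z : ℕ => z.unpair.1 := computable_fst Computable.id
    refine computable_ite_eq (he.comp (computable_snd Computable.id))
      (Computable.encode.comp ?_) z1 (Computable.const _)
    exact (Computable.list_cons.comp z1 (Computable.const [])).of_eq fun z => by simp
  have hκ : compactRep X κ K := by
    refine compactRep_of_spec fun w => ?_
    rw [hK, univ_subset_iff]
    constructor
    · rintro ⟨z, hz⟩
      simp only [κ] at hz
      split_ifs at hz with h
      · rw [hz, Denumerable.ofNat_encode] at h
        obtain ⟨ws, h1, -, h2⟩ := hvalid z.unpair.2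
        rw [h] at h2
        have h3 : [w] = ws := List.map_injective_iff.2 Encodable.encode_injective
          (Encodable.encode_injective h2)
        subst h3
        simpa using h1
      · rwa [← Encodable.encode_injective hz]
    · intro hw
      obtain ⟨i, hi⟩ := hsurj [w] (by simpa using hw) (by simp)
      refine ⟨Nat.pair (Encodable.encode w) i, ?_⟩
      simp only [κ, Nat.unpair_pair, Denumerable.ofNat_encode]
      rw [if_pos hi]
  have hcompl : ∀ i j, idealCover X (tupleRest (e i) j) = (idealCover X (tupleWord (e i) j))ᶜ := by
    intro i j
    obtain ⟨ws, h1, h2, h3⟩ := hvalid i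
    rw [h3, tupleWord_encode, tupleRest_encode, idealCover_erase_eq_compl h1 h2]
  have hclosed : ∀ i j, IsClosed (idealCover X (tupleWord (e i) j)) := fun i j =>
    ⟨hcompl i j ▸ isOpen_idealCover _⟩
  let b : ℕ → CompactOpens X := fun n =>
    ⟨⟨idealCover X (tupleWord (e n.unpair.1) n.unpair.2),
      hX.of_isClosed_subset (hclosed _ _) (subset_univ _)⟩, isOpen_idealCover _⟩
  have e1 : Computable fun n : ℕ => e n.unpair.1 := he.comp (computable_fst Computable.id)
  have e2 : Computable fun n : ℕ => n.unpair.2 := computable_snd Computable.id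
  have hN := computable_wordName (primrec_tupleRest.to_comp.comp e1 e2)
  refine hasComputableCompactOpenBasis_of_names (b := b)
    (O := fun n => wordName (tupleWord (e n.unpair.1) n.unpair.2))
    (N := fun n => wordName (tupleRest (e n.unpair.1) n.unpair.2))
    (κ := fun n => relName κ (wordName (tupleRest (e n.unpair.1) n.unpair.2)))
    ⟨computable_wordName (primrec_tupleWord.to_comp.comp e1 e2), hN,
      computable_relName (hκc.comp Computable.snd) hN, fun n => openSet_wordName _,
      fun n => (openSet_wordName _).trans (hcompl _ _), fun n => compactRep_relName hκ ?_⟩ ?_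
  · rw [openSet_wordName, hcompl, sdiff_compl, hK, univ_inter]
    rfl
  · intro x U hU hx
    obtain ⟨C, hC, hxC, hCU⟩ := exists_isClopen_of_coveringDimLE hK hdim hU hx
    obtain ⟨u, v, hd, hu, hv⟩ := exists_formallyDisjoint_of_isClopen hX hC
    -- The pair `[u, v]` is a listed tuple, and its position `0` carries `u`, that is, `C`.
    obtain ⟨i, hi⟩ := hsurj [u, v] (by simpa [hu] using hv) (by simpa using hd)
    have hb : (b (Nat.pair i 0) : Set X) = C := by
      change idealCover X (tupleWord (e (Nat.pair i 0).unpair.1) (Nat.pair i 0).unpair.2) = C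
      rw [Nat.unpair_pair, hi, tupleWord_encode]
      simpa using hu
    exact ⟨Nat.pair i 0, by change x ∈ (b _ : Set X); rwa [hb], hb ▸ hCU⟩

/-! ### Concatenating a sequence of nonempty blocks -/

/-- The concatenation of the first `n` blocks. -/
def flat (B : ℕ → List ℕ) (n : ℕ) : List ℕ := ((List.range n).map B).flatten

/-- The infinite concatenation of all blocks. -/
def flatSeq (B : ℕ → List ℕ) (i : ℕ) : ℕ := (flat B (i + 1)).getD i 0

section

variable {B : ℕ → List ℕ}

theorem flat_succ (n : ℕ) : flat B (n + 1) = flat B n ++ B n := by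
  simp [flat, List.range_succ]

theorem length_flat (n : ℕ) : (flat B n).length = ∑ k ∈ Finset.range n, (B k).length := by
  induction n with
  | zero => rfl
  | succ n ih => rw [flat_succ, List.length_append, ih, Finset.sum_range_succ]

/-- Nonempty blocks guarantee that entry `i` of the infinite concatenation is already found in the
first `i + 1` blocks. -/
theorem le_length_flat (hB : ∀ k, B k ≠ []) (n : ℕ) : n ≤ (flat B n).length := by
  induction n with
  | zero => simp
  | succ n ih =>
    rw [flat_succ, List.length_append]
    have := List.length_pos_iff.2 (hB n)
    omega

theorem flat_prefix {m n : ℕ} (h : m ≤ n) : flat B m <+: flat B n := by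
  induction n, h using Nat.le_induction with
  | base => exact List.prefix_rfl
  | succ n _ ih => exact ih.trans (flat_succ n ▸ List.prefix_append _ _)

theorem flat_getD_of_le {m n i : ℕ} (h : m ≤ n) (hi : i < (flat B m).length) :
    (flat B n).getD i 0 = (flat B m).getD i 0 := by
  obtain ⟨l, hl⟩ := flat_prefix (B := B) h
  rw [← hl, List.getD_append _ _ _ _ hi]

theorem flat_getD (hB : ∀ k, B k ≠ []) {n i : ℕ} (hi : i < (flat B n).length) :
    (flat B n).getD i 0 = flatSeq B i := by
  rcases le_total n (i + 1) with h | h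
  · exact (flat_getD_of_le h hi).symm
  · exact flat_getD_of_le h (le_length_flat hB (i + 1))

theorem flat_take (hB : ∀ k, B k ≠ []) {n i : ℕ} (hi : i ≤ (flat B n).length) :
    (flat B n).take i = Baire.pre (flatSeq B) i := by
  refine List.ext_getElem (by simpa [Baire.pre] using hi) fun j h1 h2 => ?_
  have hj : j < (flat B n).length := by simp at h1; omega
  have := flat_getD hB hj
  simp only [List.getD_eq_getElem?_getD, List.getElem?_eq_getElem hj, Option.getD_some] at this
  simp [Baire.pre, this]

/-- This matches the indexing `∑ i < n, r i + j` of the diameter condition when `r` is the sequence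
of block lengths. -/
theorem flatSeq_sum_add (hB : ∀ k, B k ≠ []) {n j : ℕ} (hj : j < (B n).length) :
    flatSeq B (∑ k ∈ Finset.range n, (B k).length + j) = (B n)[j] := by
  rw [← length_flat]
  have h : (flat B n).length + j < (flat B (n + 1)).length := by
    rw [flat_succ, List.length_append]; omega
  rw [← flat_getD hB h, flat_succ, List.getD_append_right _ _ _ _ (by omega)]
  simp [hj]

theorem exists_flatSeq_eq (hB : ∀ k, B k ≠ []) {n m : ℕ} (hm : m ∈ B n) :
    ∃ i, flatSeq B i = m := by
  obtain ⟨j, hj, rfl⟩ := List.getElem_of_mem hm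
  exact ⟨_, flatSeq_sum_add hB hj⟩

theorem flatSeq_mem (hB : ∀ k, B k ≠ []) (i : ℕ) : ∃ n, flatSeq B i ∈ B n := by
  have hi : i < (flat B (i + 1)).length := le_length_flat hB (i + 1)
  have : flatSeq B i ∈ flat B (i + 1) := by
    rw [flatSeq, List.getD_eq_getElem?_getD, List.getElem?_eq_getElem hi]
    exact List.getElem_mem hi
  simp only [flat, List.mem_flatten, List.mem_map] at this
  obtain ⟨_, ⟨n, -, rfl⟩, h⟩ := this
  exact ⟨n, h⟩

end

/-! ### Finite covers of basic sets by small basic sets -/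

section

variable {b : ℕ → CompactOpens X} {O N κ : ℕ → Baire}

/-- A computable sequence of compact open sets can be extended by the empty set. -/
theorem CompactOpenNames.exists_cons_empty (h : CompactOpenNames b O N κ) :
    ∃ (b' : ℕ → CompactOpens X) (O' N' κ' : ℕ → Baire), CompactOpenNames b' O' N' κ' ∧
      (b' 0 : Set X) = ∅ ∧ ∀ n, b' (n + 1) = b n := by
  -- For the empty set, the open name lists no ball, the name of the complement lists every ball,
  -- and the compact name lists every word, since every number codes one.
  refine ⟨fun n => n.casesOn ⊥ b, fun n => n.casesOn (fun _ => 0) O,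
    fun n => n.casesOn (fun i => i + 1) N, fun n => n.casesOn (fun i => i) κ,
    ⟨?_, ?_, ?_, ?_, ?_, ?_⟩, rfl, fun _ => rfl⟩
  · refine (Computable.nat_casesOn (h := fun (p : ℕ × ℕ) n => O n p.2) Computable.fst
      (Computable.const 0) (h.computable_O.comp Computable.snd
        (Computable.snd.comp Computable.fst))).of_eq ?_
    rintro ⟨_ | n, i⟩ <;> rfl
  · refine (Computable.nat_casesOn (h := fun (p : ℕ × ℕ) n => N n p.2) Computable.fst
      (Computable.succ.comp Computable.snd) (h.computable_N.comp Computable.snd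
        (Computable.snd.comp Computable.fst))).of_eq ?_
    rintro ⟨_ | n, i⟩ <;> rfl
  · refine (Computable.nat_casesOn (h := fun (p : ℕ × ℕ) n => κ n p.2) Computable.fst
      Computable.snd (h.computable_κ.comp Computable.snd
        (Computable.snd.comp Computable.fst))).of_eq ?_
    rintro ⟨_ | n, i⟩ <;> rfl
  · rintro (_ | n)
    · ext x; simp [mem_openSet]
    · exact h.openSet_O n
  · rintro (_ | n)
    · refine (eq_univ_of_forall fun x => ?_).trans compl_empty.symm
      obtain ⟨i, hi⟩ := ComputableMetricSpace.dense_ν.exists_dist_lt x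
        (radius_pos (Nat.pair 0 0))
      refine mem_openSet.2 ⟨Nat.pair i 0, Nat.pair i 0, rfl, ?_⟩
      simpa [idealBall, center, radius] using hi
    · exact h.openSet_N n
  · rintro (_ | n)
    · exact compactRep_of_spec fun w => ⟨fun _ => empty_subset _, fun _ => ⟨_, rfl⟩⟩
    · exact h.compactRep_κ n

/-- A name of the union of a sequence of named open sets. -/
def unionName (O : ℕ → Baire) (f : ℕ → ℕ) : Baire := fun x => O (f x.unpair.1) x.unpair.2

theorem openSet_unionName (h : CompactOpenNames b O N κ) (f : ℕ → ℕ) :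
    openSet X (unionName O f) = ⋃ u, (b (f u) : Set X) := by
  ext x
  simp only [mem_iUnion, ← h.openSet_O, mem_openSet, unionName]
  constructor
  · rintro ⟨i, a, h1, h2⟩
    exact ⟨i.unpair.1, i.unpair.2, a, h1, h2⟩
  · rintro ⟨u, i, a, h1, h2⟩
    exact ⟨Nat.pair u i, a, by simpa using h1, h2⟩

theorem computable_unionName {α : Type*} [Primcodable α] (hO : Computable₂ O) {f : α → ℕ → ℕ}
    (hf : Computable₂ f) : Computable₂ fun a => unionName O (f a) :=
  hO.comp (hf.comp Computable.fst (computable_fst Computable.snd)) (computable_snd Computable.snd)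

/-- Twice the radius of the ideal ball `e` is less than `1 / (k + 1)`. -/
def radiusTest (k e : ℕ) : ℕ :=
  2 * (e.unpair.2.unpair.1 + 1) * (k + 1) - e.unpair.2.unpair.2

/-- Cross-multiplying gives a strict inequality with right side of the form `c + 1`, i.e. `≤ c`,
which is the vanishing of a truncated subtraction. -/
theorem radiusTest_eq_zero (k e : ℕ) : radiusTest k e = 0 ↔ 2 * radius e < ((k : ℝ) + 1)⁻¹ := by
  have h1 : (0 : ℝ) < (k : ℝ) + 1 := by positivity
  have h2 : (0 : ℝ) < (e.unpair.2.unpair.2 : ℝ) + 1 := by positivity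
  have : radius e = ((e.unpair.2.unpair.1 : ℝ) + 1) / ((e.unpair.2.unpair.2 : ℝ) + 1) := by
    simp [radius, posRat]
  rw [this, radiusTest, Nat.sub_eq_zero_iff_le, ← Nat.lt_succ_iff, ← mul_div_assoc,
    inv_eq_one_div, div_lt_div_iff₀ h2 h1, one_mul]
  exact_mod_cast Iff.rfl

theorem primrec_radiusTest : Primrec₂ radiusTest := by
  have e : Primrec fun x : ℕ × ℕ => x.2.unpair.2.unpair := Primrec.unpair.comp
    (Primrec.snd.comp (Primrec.unpair.comp Primrec.snd))
  exact Primrec.nat_sub.comp (Primrec.nat_mul.comp (Primrec.nat_mul.comp (Primrec.const 2)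
    (Primrec.succ.comp (Primrec.fst.comp e))) (Primrec.succ.comp Primrec.fst)) (Primrec.snd.comp e)

/-- For varying `u`, this enumerates basic sets which are contained in the `n`-th basic set and
have diameter less than `1 / (k + 1)`. -/
def smallIndex (O κ : ℕ → Baire) (k n u : ℕ) : ℕ :=
  if radiusTest k u.unpair.2.unpair.1 = 0 then
    if κ u.unpair.1 u.unpair.2.unpair.2.unpair.1 = Encodable.encode [u.unpair.2.unpair.1] then
      if κ u.unpair.1 u.unpair.2.unpair.2.unpair.2.unpair.1 =
          Encodable.encode (coverWord ((O n).pre u.unpair.2.unpair.2.unpair.2.unpair.2))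
      then u.unpair.1 else 0
    else 0
  else 0

theorem computable_smallIndex (hO : Computable₂ O) (hκ : Computable₂ κ) :
    Computable₂ fun x : ℕ × ℕ => smallIndex O κ x.1 x.2 := by
  have u1 : Computable fun x : (ℕ × ℕ) × ℕ => x.2.unpair.1 := computable_fst Computable.snd
  have u2 : Computable fun x : (ℕ × ℕ) × ℕ => x.2.unpair.2 := computable_snd Computable.snd
  have u3 := computable_snd u2
  have u4 := computable_snd u3
  have hq : Computable₂ fun x : (ℕ × ℕ) × ℕ => O x.1.2 :=
    hO.comp (Computable.snd.comp (Computable.fst.comp Computable.fst)) Computable.snd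
  refine computable_ite_eq (primrec_radiusTest.to_comp.comp
    (Computable.fst.comp Computable.fst) (computable_fst u2)) (Computable.const 0)
    (computable_ite_eq (hκ.comp u1 (computable_fst u3))
      (Computable.encode.comp (Computable.list_cons.comp (computable_fst u2) (Computable.const [])))
      (computable_ite_eq (hκ.comp u1 (computable_fst u4))
        (computable_coverWord_pre hq (computable_snd u4)) u1 (Computable.const 0))
      (Computable.const 0)) (Computable.const 0)

/-- A candidate passes only with certificates that it lies in a small ball and in the `n`-th basic
set; failures fall back to index `0`, the empty set. -/
theorem smallIndex_spec (h : CompactOpenNames b O N κ) (h0 : (b 0 : Set X) = ∅) (k n u : ℕ) :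
    (b (smallIndex O κ k n u) : Set X) ⊆ b n ∧
      Metric.diam (b (smallIndex O κ k n u) : Set X) < ((k : ℝ) + 1)⁻¹ := by
  have hempty : (b 0 : Set X) ⊆ b n ∧ Metric.diam (b 0 : Set X) < ((k : ℝ) + 1)⁻¹ := by
    rw [h0, Metric.diam_empty]
    exact ⟨empty_subset _, by positivity⟩
  unfold smallIndex
  split_ifs with h1 h2 h3
  · constructor
    · rw [← h.openSet_O n]
      exact (compactRep_subset_openSet (h.compactRep_κ _) _).1 ⟨_, _, h3⟩
    · have := (compactRep_spec (h.compactRep_κ _) _).1 ⟨_, h2⟩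
      rw [idealCover_singleton] at this
      refine ((Metric.diam_mono this Metric.isBounded_ball).trans
        (Metric.diam_ball (radius_pos _).le)).trans_lt ((radiusTest_eq_zero _ _).1 h1)
  all_goals exact hempty

theorem exists_mem_smallIndex (h : CompactOpenNames b O N κ)
    (hb : ∀ (x : X) (U : Set X), IsOpen U → x ∈ U → ∃ n, x ∈ b n ∧ (b n : Set X) ⊆ U)
    (k n : ℕ) {x : X} (hx : x ∈ b n) : ∃ u, x ∈ b (smallIndex O κ k n u) := by
  -- Balls of radius `1 / (l + 1)` then have twice their radius below `1 / (k + 1)`.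
  obtain ⟨l, hl⟩ := exists_nat_gt (2 * ((k : ℝ) + 1))
  have hr : ∀ i, radiusTest k (Nat.pair i (Nat.pair 0 l)) = 0 := by
    intro i
    have : 2 * (k + 1) < l := by exact_mod_cast hl
    simp [radiusTest]
    omega
  obtain ⟨i, hi⟩ := ComputableMetricSpace.dense_ν.exists_dist_lt x
    (radius_pos (Nat.pair 0 (Nat.pair 0 l)))
  have hball : x ∈ idealBall X (Nat.pair i (Nat.pair 0 l)) := by
    simpa [idealBall, center, radius] using hi
  obtain ⟨m, hxm, hm⟩ := hb x _ ((b n).isOpen.inter (isOpen_idealBall _)) ⟨hx, hball⟩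
  obtain ⟨t, ht⟩ := (compactRep_spec (h.compactRep_κ m) [Nat.pair i (Nat.pair 0 l)]).2
    (by rw [idealCover_singleton]; exact hm.trans inter_subset_right)
  obtain ⟨s, t', hst⟩ := (compactRep_subset_openSet (h.compactRep_κ m) (O n)).2
    (by rw [h.openSet_O]; exact hm.trans inter_subset_left)
  refine ⟨Nat.pair m (Nat.pair (Nat.pair i (Nat.pair 0 l)) (Nat.pair t (Nat.pair t' s))), ?_⟩
  unfold smallIndex
  simp only [Nat.unpair_pair]
  rwa [if_pos (hr i), if_pos ht, if_pos hst]

/-- Every basic set can be computably covered by finitely many basic subsets of small diameter. -/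
theorem CompactOpenNames.exists_blocks (h : CompactOpenNames b O N κ) (h0 : (b 0 : Set X) = ∅)
    (hb : ∀ (x : X) (U : Set X), IsOpen U → x ∈ U → ∃ n, x ∈ b n ∧ (b n : Set X) ⊆ U) :
    ∃ blk : ℕ → ℕ → List ℕ, Computable₂ blk ∧ ∀ k n, blk k n ≠ [] ∧
      (∀ m ∈ blk k n, Metric.diam (b m : Set X) < ((k : ℝ) + 1)⁻¹) ∧
      ⋃ m ∈ blk k n, (b m : Set X) = b n := by
  have hsmall := computable_smallIndex h.computable_O h.computable_κ
  let P : ℕ × ℕ → ℕ → Bool := fun x z => decide (κ x.2 z.unpair.2 =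
    Encodable.encode (coverWord ((unionName O (smallIndex O κ x.1 x.2)).pre z.unpair.1)))
  have hP : Computable₂ P := by
    have hq : Computable₂ fun x : (ℕ × ℕ) × ℕ => unionName O (smallIndex O κ x.1.1 x.1.2) :=
      computable_unionName h.computable_O
        (hsmall.comp (Computable.fst.comp Computable.fst) Computable.snd)
    exact computable_decide_eq
      (h.computable_κ.comp (Computable.snd.comp Computable.fst) (computable_snd Computable.snd))
      (computable_coverWord_pre hq (computable_fst Computable.snd))
  have hex : ∀ x, ∃ z, P x z = true := by
    intro x
    obtain ⟨s, t, hst⟩ := (compactRep_subset_openSet (h.compactRep_κ x.2)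
      (unionName O (smallIndex O κ x.1 x.2))).2 (by
        rw [openSet_unionName h]
        intro y hy
        exact mem_iUnion.2 (exists_mem_smallIndex h hb x.1 x.2 hy))
    exact ⟨Nat.pair s t, by simpa [P] using hst⟩
  obtain ⟨f, hf, hfP⟩ := exists_computable_find hP hex
  -- A certificate `⟨s, t⟩` uses only the first `s` entries of the union name, and entry `i` comes
  -- from piece `i.unpair.1 ≤ i`, so the pieces up to `s` suffice. The `+ 1` keeps the block
  -- nonempty.
  refine ⟨fun k n => (List.range ((f (k, n)).unpair.1 + 1)).map (smallIndex O κ k n),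
    computable_map_range (Computable.succ.comp (computable_fst hf)) hsmall,
    fun k n => ⟨by simp, ?_, ?_⟩⟩
  · intro m hm
    obtain ⟨u, -, rfl⟩ := List.mem_map.1 hm
    exact (smallIndex_spec h h0 k n u).2
  · refine Subset.antisymm (iUnion₂_subset fun m hm => ?_) ?_
    · obtain ⟨u, -, rfl⟩ := List.mem_map.1 hm
      exact (smallIndex_spec h h0 k n u).1
    · have hz := hfP (k, n)
      simp only [P, decide_eq_true_eq] at hz
      refine ((compactRep_spec (h.compactRep_κ n) _).1 ⟨_, hz⟩).trans fun x hx => ?_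
      obtain ⟨a, ha, hxa⟩ := mem_idealCover.1 hx
      obtain ⟨i, hi, hia⟩ := mem_pre.1 (mem_coverWord.1 ha)
      refine mem_iUnion₂.2 ⟨smallIndex O κ k n i.unpair.1, List.mem_map.2
        ⟨_, List.mem_range.2 (Nat.lt_succ_of_le ((Nat.unpair_left_le i).trans hi.le)), rfl⟩, ?_⟩
      rw [← h.openSet_O]
      exact mem_openSet.2 ⟨_, a, hia, hxa⟩

end

/-! ### Differences of basic sets: names and decidable emptiness -/

section

variable {b : ℕ → CompactOpens X} {O N κ : ℕ → Baire}

/-- The `m`-th basic set minus the basic sets with indices in `L`. -/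
def basicDiff (b : ℕ → CompactOpens X) (x : List ℕ × ℕ) : Clopens X :=
  ⟨(b x.2 : Set X) \ ⋃ j ∈ x.1, (b j : Set X), by
    have h : IsClopen (⋃ j ∈ x.1, (b j : Set X)) :=
      (List.finite_toSet x.1).isClopen_biUnion fun j _ => (b j).toClopens.isClopen
    exact (b x.2).toClopens.isClopen.diff h⟩

theorem coe_basicDiff (x : List ℕ × ℕ) :
    (basicDiff b x : Set X) = (b x.2 : Set X) \ ⋃ j ∈ x.1, (b j : Set X) := rfl

/-- A number which is `0` iff the inclusion of the compact set with name `κ` in `openSet q` is not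
confirmed by the first `s` entries of `q` and the first `t` entries of `κ`. -/
def inclusionTest (κ q : Baire) (s t : ℕ) : ℕ :=
  (decide (Encodable.encode (coverWord (q.pre s)) ∈ κ.pre t)).toNat

theorem subset_of_inclusionTest {p q : Baire} {K : Compacts X} (h : compactRep X p K) {s t : ℕ}
    (hst : inclusionTest p q s t ≠ 0) : (K : Set X) ⊆ openSet X q := by
  simp only [inclusionTest, ne_eq, Bool.toNat_eq_zero, decide_eq_false_iff_not, not_not,
    mem_pre] at hst
  obtain ⟨i, -, hi⟩ := hst
  exact (compactRep_subset_openSet h q).1 ⟨s, i, hi⟩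

/-- Stages of `q` increase and a compact name lists every cover, so confirmation persists. The
eventual form allows finitely many tests to share the same `s` and `t`. -/
theorem eventually_inclusionTest {p q : Baire} {K : Compacts X} (h : compactRep X p K)
    (hK : (K : Set X) ⊆ openSet X q) :
    ∀ᶠ s in Filter.atTop, ∀ᶠ t in Filter.atTop, inclusionTest p q s t ≠ 0 := by
  obtain ⟨s₀, t₀, h₀⟩ := (compactRep_subset_openSet h q).2 hK
  filter_upwards [Filter.eventually_ge_atTop s₀] with s hs
  obtain ⟨t₁, h₁⟩ := (compactRep_spec h (coverWord (q.pre s))).2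
    (((compactRep_spec h _).1 ⟨t₀, h₀⟩).trans (monotone_idealCover_coverWord q hs))
  filter_upwards [Filter.eventually_gt_atTop t₁] with t ht
  simp only [inclusionTest, ne_eq, Bool.toNat_eq_zero, decide_eq_false_iff_not, not_not, mem_pre]
  exact ⟨t₁, ht, h₁⟩

theorem computable_inclusionTest {α : Type*} [Primcodable α] {p q : α → Baire} {s t : α → ℕ}
    (hp : Computable₂ p) (hq : Computable₂ q) (hs : Computable s) (ht : Computable t) :
    Computable fun a => inclusionTest (p a) (q a) (s a) (t a) :=
  (Primrec.dom_bool Bool.toNat).to_comp.comp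
    (computable_decide_mem (computable_coverWord_pre hq hs) (computable_pre hp ht))

/-- A name of `basicDiff b x` as an open set: it lists all balls of basic sets whose inclusion
in `basicDiff b x` is confirmed. -/
def diffName (O N κ : ℕ → Baire) (x : List ℕ × ℕ) : Baire := fun y =>
  bif decide (0 ∈ inclusionTest (κ y.unpair.1) (O x.2) y.unpair.2.unpair.1
        y.unpair.2.unpair.2.unpair.1 ::
      x.1.map fun j => inclusionTest (κ y.unpair.1) (N j) y.unpair.2.unpair.1
        y.unpair.2.unpair.2.unpair.1)
  then 0 else O y.unpair.1 y.unpair.2.unpair.2.unpair.2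

theorem computable_diffName (h : CompactOpenNames b O N κ) : Computable₂ (diffName O N κ) := by
  have y1 : Computable fun p : (List ℕ × ℕ) × ℕ => p.2.unpair.1 := computable_fst Computable.snd
  have y2 : Computable fun p : (List ℕ × ℕ) × ℕ => p.2.unpair.2 := computable_snd Computable.snd
  have y3 := computable_snd y2
  have hκ : Computable₂ fun p : (List ℕ × ℕ) × ℕ => κ p.2.unpair.1 :=
    h.computable_κ.comp (y1.comp Computable.fst) Computable.snd
  have hO : Computable₂ fun p : (List ℕ × ℕ) × ℕ => O p.1.2 :=
    h.computable_O.comp (Computable.snd.comp (Computable.fst.comp Computable.fst)) Computable.snd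
  have hN : Computable₂ fun p : ((List ℕ × ℕ) × ℕ) × ℕ => N p.2 :=
    h.computable_N.comp (Computable.snd.comp Computable.fst) Computable.snd
  have hκ' : Computable₂ fun p : ((List ℕ × ℕ) × ℕ) × ℕ => κ p.1.2.unpair.1 :=
    h.computable_κ.comp (y1.comp (Computable.fst.comp Computable.fst)) Computable.snd
  exact Computable.cond
    (computable_decide_mem (Computable.const 0) (Computable.list_cons.comp
      (computable_inclusionTest hκ hO (computable_fst y2) (computable_fst y3))
      (computable_list_map (Computable.fst.comp Computable.fst)
        (computable_inclusionTest hκ' hN ((computable_fst y2).comp Computable.fst)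
          ((computable_fst y3).comp Computable.fst)))))
    (Computable.const 0) (h.computable_O.comp y1 (computable_snd y3))

/-- The difference is open, so it is the union of the basic sets inside it, and such an inclusion
amounts to finitely many: into the positive set, and into the complement of each subtracted one. -/
theorem openSet_diffName (h : CompactOpenNames b O N κ)
    (hb : ∀ (x : X) (U : Set X), IsOpen U → x ∈ U → ∃ n, x ∈ b n ∧ (b n : Set X) ⊆ U)
    (x : List ℕ × ℕ) : openSet X (diffName O N κ x) = basicDiff b x := by
  ext z
  rw [mem_openSet]
  constructor
  · rintro ⟨y, a, hy, hz⟩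
    unfold diffName at hy
    rw [Bool.cond_decide] at hy
    split_ifs at hy with hmem
    simp only [List.mem_cons, List.mem_map, not_or, not_exists, not_and] at hmem
    have hzn : z ∈ (b y.unpair.1 : Set X) := by
      rw [← h.openSet_O]
      exact mem_openSet.2 ⟨_, a, hy, hz⟩
    rw [coe_basicDiff, ← h.openSet_O]
    refine ⟨subset_of_inclusionTest (h.compactRep_κ _) (fun e => hmem.1 e.symm) hzn, ?_⟩
    simp only [mem_iUnion, not_exists]
    intro j hj hzj
    have := subset_of_inclusionTest (h.compactRep_κ _) (hmem.2 j hj) hzn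
    rw [h.openSet_N] at this
    exact this hzj
  · intro hz
    obtain ⟨n, hzn, hn⟩ := hb z _ (basicDiff b x).isClopen.2 hz
    rw [coe_basicDiff] at hn
    have h1 := eventually_inclusionTest (h.compactRep_κ n) (q := O x.2)
      (by rw [h.openSet_O]; exact hn.trans sdiff_subset)
    have h2 : ∀ᶠ s in Filter.atTop, ∀ j ∈ {j | j ∈ x.1}, ∀ᶠ t in Filter.atTop,
        inclusionTest (κ n) (N j) s t ≠ 0 := by
      refine (Filter.eventually_all_finite (List.finite_toSet x.1)).2 fun j hj => ?_
      refine eventually_inclusionTest (h.compactRep_κ n) ?_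
      rw [h.openSet_N]
      exact fun w hw hwj => (hn hw).2 (mem_iUnion₂.2 ⟨j, hj, hwj⟩)
    -- The threshold for `t` depends on `s`, so a common `s` is fixed before a common `t`.
    obtain ⟨s, hs1, hs2⟩ := (h1.and h2).exists
    obtain ⟨t, ht1, ht2⟩ := (hs1.and
      ((Filter.eventually_all_finite (List.finite_toSet x.1)).2 hs2)).exists
    have hzn' : z ∈ openSet X (O n) := by rw [h.openSet_O]; exact hzn
    obtain ⟨i, a, hi, hza⟩ := mem_openSet.1 hzn'
    refine ⟨Nat.pair n (Nat.pair s (Nat.pair t i)), a, ?_, hza⟩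
    unfold diffName
    rw [Bool.cond_decide, if_neg]
    · simpa using hi
    · simp only [Nat.unpair_pair, List.mem_cons, List.mem_map, not_or, not_exists, not_and]
      exact ⟨fun e => ht1 e.symm, fun j hj => ht2 j hj⟩

/-- A name of the complement of `basicDiff b x`. -/
def diffComplName (O N : ℕ → Baire) (x : List ℕ × ℕ) : Baire := fun y =>
  if y.unpair.1 = 0 then N x.2 y.unpair.2 else O (x.1.getD (y.unpair.1 - 1) 0) y.unpair.2

theorem computable_diffComplName (h : CompactOpenNames b O N κ) :
    Computable₂ (diffComplName O N) := by
  have y1 : Computable fun p : (List ℕ × ℕ) × ℕ => p.2.unpair.1 := computable_fst Computable.snd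
  have y2 : Computable fun p : (List ℕ × ℕ) × ℕ => p.2.unpair.2 := computable_snd Computable.snd
  exact computable_ite_eq y1 (Computable.const 0)
    (h.computable_N.comp (Computable.snd.comp Computable.fst) y2)
    (h.computable_O.comp ((Primrec.list_getD 0).to_comp.comp
      (Computable.fst.comp Computable.fst) (Computable.pred.comp y1)) y2)

/-- The default index `0` stands for the empty set, so reading past the end of the list adds
nothing. -/
theorem iUnion_getD (h0 : (b 0 : Set X) = ∅) (L : List ℕ) :
    ⋃ u, (b (L.getD u 0) : Set X) = ⋃ j ∈ L, (b j : Set X) := by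
  refine Subset.antisymm (iUnion_subset fun u => ?_) (iUnion₂_subset fun j hj => ?_)
  · by_cases hu : u < L.length
    · rw [List.getD_eq_getElem _ _ hu]
      exact subset_biUnion_of_mem (u := fun j => (b j : Set X)) (List.getElem_mem hu)
    · rw [List.getD_eq_default _ _ (not_lt.1 hu), h0]
      exact empty_subset _
  · obtain ⟨u, hu, rfl⟩ := List.getElem_of_mem hj
    rw [← List.getD_eq_getElem _ 0 hu]
    exact subset_iUnion (fun u => (b (L.getD u 0) : Set X)) u

theorem openSet_diffComplName (h : CompactOpenNames b O N κ) (h0 : (b 0 : Set X) = ∅)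
    (x : List ℕ × ℕ) : openSet X (diffComplName O N x) = (basicDiff b x : Set X)ᶜ := by
  have : openSet X (diffComplName O N x) =
      openSet X (N x.2) ∪ openSet X (unionName O fun u => x.1.getD u 0) := by
    ext z
    simp only [mem_union, mem_openSet, diffComplName, unionName]
    constructor
    · rintro ⟨y, a, hy, hz⟩
      split_ifs at hy with hu
      · exact Or.inl ⟨_, a, hy, hz⟩
      · exact Or.inr ⟨Nat.pair (y.unpair.1 - 1) y.unpair.2, a, by simpa using hy, hz⟩
    · rintro (⟨y, a, hy, hz⟩ | ⟨y, a, hy, hz⟩)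
      · exact ⟨Nat.pair 0 y, a, by simpa using hy, hz⟩
      · exact ⟨Nat.pair (y.unpair.1 + 1) y.unpair.2, a, by simpa using hy, hz⟩
  rw [this, h.openSet_N, openSet_unionName h, iUnion_getD h0, coe_basicDiff, sdiff_eq,
    compl_inter, compl_compl]

/-- Emptiness of differences of basic sets is decidable. -/
theorem exists_emptinessBit (h : CompactOpenNames b O N κ) (h0 : (b 0 : Set X) = ∅)
    (hb : ∀ (x : X) (U : Set X), IsOpen U → x ∈ U → ∃ n, x ∈ b n ∧ (b n : Set X) ⊆ U) :
    ∃ s : List ℕ × ℕ → ℕ, Computable s ∧ ∀ x, s x < 2 ∧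
      ((basicDiff b x : Set X) = ∅ ↔ s x = 0) := by
  let q : List ℕ × ℕ → Baire := fun x => unionName O fun u => x.1.getD u 0
  have hq : Computable₂ q := computable_unionName h.computable_O
    ((Primrec.list_getD 0).to_comp.comp (Computable.fst.comp Computable.fst) Computable.snd)
  have hqx : ∀ x, (∃ s t, κ x.2 t = Encodable.encode (coverWord ((q x).pre s))) ↔
      (basicDiff b x : Set X) = ∅ := by
    intro x
    rw [compactRep_subset_openSet (h.compactRep_κ x.2), openSet_unionName h, iUnion_getD h0,
      coe_basicDiff]
    exact sdiff_eq_empty.symm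
  -- Ideal balls contain their centres, so a single listed ball certifies nonemptiness.
  have hD : ∀ x y, diffName O N κ x y ≠ 0 → (basicDiff b x : Set X) ≠ ∅ := by
    intro x y hy
    rw [← openSet_diffName h hb]
    obtain ⟨a, ha⟩ := Nat.exists_eq_succ_of_ne_zero hy
    exact Nonempty.ne_empty ⟨center X a, mem_openSet.2 ⟨y, a, ha, center_mem a⟩⟩
  have hcD := computable_diffName h
  -- Search in parallel for a certificate of emptiness (the subtracted sets cover) or of
  -- nonemptiness (a ball is listed); one of them always exists.
  let P : List ℕ × ℕ → ℕ → Bool := fun x z =>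
    decide (κ x.2 z.unpair.2 = Encodable.encode (coverWord ((q x).pre z.unpair.1))) ||
      !decide (diffName O N κ x z = 0)
  have hP : Computable₂ P := by
    have hq' : Computable₂ fun p : (List ℕ × ℕ) × ℕ => q p.1 :=
      hq.comp (Computable.fst.comp Computable.fst) Computable.snd
    exact Primrec.or.to_comp.comp
      (computable_decide_eq (h.computable_κ.comp (Computable.snd.comp Computable.fst)
        (computable_snd Computable.snd)) (computable_coverWord_pre hq'
          (computable_fst Computable.snd)))
      (Primrec.not.to_comp.comp (computable_decide_eq hcD (Computable.const 0)))
  have hPiff : ∀ x z, P x z = true ↔ κ x.2 z.unpair.2 =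
      Encodable.encode (coverWord ((q x).pre z.unpair.1)) ∨ diffName O N κ x z ≠ 0 := by
    intro x z; simp [P]
  have hex : ∀ x, ∃ z, P x z = true := by
    intro x
    simp only [hPiff]
    rcases eq_empty_or_nonempty (basicDiff b x : Set X) with he | ⟨z, hz⟩
    · obtain ⟨s, t, hst⟩ := (hqx x).2 he
      exact ⟨Nat.pair s t, Or.inl (by simpa using hst)⟩
    · rw [← openSet_diffName h hb] at hz
      obtain ⟨i, a, hi, -⟩ := mem_openSet.1 hz
      exact ⟨i, Or.inr (by omega)⟩
  obtain ⟨f, hf, hfP⟩ := exists_computable_find hP hex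
  refine ⟨fun x => if diffName O N κ x (f x) = 0 then 0 else 1,
    computable_ite_eq (hcD.comp Computable.id hf) (Computable.const 0) (Computable.const 0)
      (Computable.const 1), fun x => ⟨by dsimp only; split_ifs <;> simp, ?_⟩⟩
  dsimp only
  split_ifs with hx
  · exact iff_of_true ((hqx x).1 ⟨_, _, ((hPiff _ _).1 (hfP x)).resolve_right (not_not.2 hx)⟩)
      (by simp)
  · exact iff_of_false (hD _ _ hx) (by simp)

end

/-! ### The realiser of the decomposition operation -/

section Realiser

variable {α : Type*} [Primcodable α]

/-- The index of the basic set which is considered in stage `k`: it is contained in the ball with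
index `v - 1` (or is the empty set). -/
def stageIndex (κ : ℕ → Baire) (v k : ℕ) : ℕ :=
  if v = 0 then 0 else
    if κ k.unpair.2.unpair.1 k.unpair.2.unpair.2 = Encodable.encode [v - 1]
    then k.unpair.2.unpair.1 else 0

theorem computable_stageIndex {κ : ℕ → Baire} (hκ : Computable₂ κ) :
    Computable₂ (stageIndex κ) := by
  have k2 : Computable fun p : ℕ × ℕ => p.2.unpair.2 := computable_snd Computable.snd
  exact computable_ite_eq Computable.fst (Computable.const 0) (Computable.const 0)
    (computable_ite_eq (hκ.comp (computable_fst k2) (computable_snd k2))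
      (Computable.encode.comp (Computable.list_cons.comp (Computable.pred.comp Computable.fst)
        (Computable.const []))) (computable_fst k2) (Computable.const 0))

/-- The concatenation of the blocks which are determined by the list `l` of stage indices. -/
def listFlat (blk : ℕ → ℕ → List ℕ) (l : List ℕ) : List ℕ :=
  flat (fun k => blk k (l.getD k 0)) l.length

theorem computable_listFlat {blk : ℕ → ℕ → List ℕ} (hblk : Computable₂ blk) :
    Computable (listFlat blk) :=
  Primrec.list_flatten.to_comp.comp (computable_map_range Computable.list_length
    (hblk.comp Computable.snd
      ((Primrec.list_getD 0).to_comp.comp Computable.fst Computable.snd)))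

theorem pre_getD {c : Baire} {i n : ℕ} (h : i < n) : (c.pre n).getD i 0 = c i := by
  simp [Baire.pre, h]

theorem listFlat_pre (blk : ℕ → ℕ → List ℕ) (c : Baire) (n : ℕ) :
    listFlat blk (c.pre n) = flat (fun k => blk k (c k)) n := by
  have : (c.pre n).length = n := by simp [Baire.pre]
  rw [listFlat, flat, flat, this]
  congr 1
  refine List.map_congr_left fun k hk => ?_
  rw [pre_getD (List.mem_range.1 hk)]

/-- The output sequence, as a function of names `Z (L, m)` of the differences of basic sets, bits
`s (L, m)`, the sequence `m` of basic sets, and the block lengths `r`. -/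
def outputName (Z : List ℕ × ℕ → Baire) (s : List ℕ × ℕ → ℕ) (x : ℕ → List ℕ × ℕ) (r : ℕ → ℕ) :
    Baire :=
  tuple (tuple (fun y => Z (x y.unpair.1) y.unpair.2) r) fun i => s (x i)

theorem computable_outputName {Z : List ℕ × ℕ → Baire} {s : List ℕ × ℕ → ℕ}
    {x : α → ℕ → List ℕ × ℕ} {r : α → ℕ → ℕ} (hZ : Computable₂ Z) (hs : Computable s)
    (hx : Computable₂ x) (hr : Computable₂ r) :
    Computable₂ fun a => outputName Z s (x a) (r a) :=
  computable_tuple (computable_tuple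
    (hZ.comp (hx.comp Computable.fst (computable_fst Computable.snd))
      (computable_snd Computable.snd))
    hr) (hs.comp hx)

/-- Halving and unpairing do not increase a number, so digit `n` involves only entries with index at
most `n`. -/
theorem outputName_congr (Z : List ℕ × ℕ → Baire) (s : List ℕ × ℕ → ℕ) {x x' : ℕ → List ℕ × ℕ}
    {r r' : ℕ → ℕ} {n : ℕ} (hx : ∀ i ≤ n, x i = x' i) (hr : ∀ i ≤ n, r i = r' i) :
    outputName Z s x r n = outputName Z s x' r' n := by
  have h1 : n / 2 ≤ n := Nat.div_le_self _ _
  have h2 : n / 2 / 2 ≤ n := (Nat.div_le_self _ _).trans h1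
  unfold outputName tuple
  dsimp only
  rw [hx _ ((Nat.unpair_left_le _).trans h2), hr _ h2, hx _ h1]

/-- An operation is computable if the `n`-th digit of the output is computable from the first
`n + 1` entries of a sequence whose `k`-th entry is computable from `k` and one input digit. -/
theorem produces_of_prefix {C : ℕ → ℕ → ℕ} {ι : ℕ → ℕ} {Q : List ℕ → ℕ → ℕ}
    (hC : Computable₂ C) (hι : Computable ι) (hle : ∀ k, ι k ≤ 2 * k) (hQ : Computable₂ Q) :
    ∃ φ : List ℕ → ℕ → Option ℕ, Computable₂ φ ∧ ∀ p : Baire,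
      Produces φ p fun n => Q (Baire.pre (fun k => C (p (ι k)) k) (n + 1)) n := by
  refine ⟨fun w n => if w.length - 2 * n = 0 then none else
    some (Q ((List.range (n + 1)).map fun k => C (w.getD (ι k) 0) k) n), ?_, fun p n => ?_⟩
  · have hpre : Computable fun x : List ℕ × ℕ =>
        (List.range (x.2 + 1)).map fun k => C (x.1.getD (ι k) 0) k :=
      computable_map_range (Computable.succ.comp Computable.snd)
        (hC.comp ((Primrec.list_getD 0).to_comp.comp (Computable.fst.comp Computable.fst)
          (hι.comp Computable.snd)) Computable.snd)
    exact computable_ite_eq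
      (Primrec.nat_sub.to_comp.comp (Computable.list_length.comp Computable.fst)
        (Primrec.nat_double.to_comp.comp Computable.snd))
      (Computable.const 0) (Computable.const none)
      (Computable.option_some.comp (hQ.comp hpre Computable.snd))
  · have hlen : ∀ j, (p.pre j).length = j := fun j => by simp [Baire.pre]
    -- Stages `k ≤ n` read positions `ι k ≤ 2 * n`, so a prefix of length `2 * n + 1` contains them
    -- all.
    refine ⟨2 * n + 1, ?_, fun j hj => ?_⟩
    · dsimp only
      rw [hlen, if_neg (by omega)]
      congr 2
      refine List.map_congr_left fun k hk => ?_
      have := List.mem_range.1 hk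
      have := hle k
      rw [pre_getD (by omega)]
    · dsimp only
      rw [hlen, if_pos (by omega)]

end Realiser

/-- A stage `⟨i, ⟨m, t⟩⟩` accepts basic set `m` when entry `t` of its compact name confirms that it
lies in the `i`-th listed ball. Basic sets inside a ball exhaust it, so all stages together exhaust
the open set. -/
theorem CompactOpenNames.iUnion_stageIndex {b : ℕ → CompactOpens X} {O N κ : ℕ → Baire}
    (h : CompactOpenNames b O N κ) (h0 : (b 0 : Set X) = ∅)
    (hb : ∀ (x : X) (U : Set X), IsOpen U → x ∈ U → ∃ n, x ∈ b n ∧ (b n : Set X) ⊆ U)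
    (p : Baire) : ⋃ k, (b (stageIndex κ (p k.unpair.1) k) : Set X) = openSet X p := by
  refine Subset.antisymm (iUnion_subset fun k => ?_) fun x hx => ?_
  · unfold stageIndex
    split_ifs with h1 h2
    · exact h0 ▸ empty_subset _
    · have := (compactRep_spec (h.compactRep_κ _) _).1 ⟨_, h2⟩
      rw [idealCover_singleton] at this
      exact fun x hx => mem_openSet.2 ⟨k.unpair.1, p k.unpair.1 - 1, by omega, this hx⟩
    · exact h0 ▸ empty_subset _
  · obtain ⟨i, a, hi, hxa⟩ := mem_openSet.1 hx
    obtain ⟨m, hxm, hm⟩ := hb x _ (isOpen_idealBall a) hxa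
    rw [← idealCover_singleton] at hm
    obtain ⟨t, ht⟩ := (compactRep_spec (h.compactRep_κ m) [a]).2 hm
    refine mem_iUnion.2 ⟨Nat.pair i (Nat.pair m t), ?_⟩
    have hst : stageIndex κ (p (Nat.pair i (Nat.pair m t)).unpair.1)
        (Nat.pair i (Nat.pair m t)) = m := by
      unfold stageIndex
      simp [hi, ht]
    rw [hst]
    exact hxm

theorem basicDiff_pre (b : ℕ → CompactOpens X) (m : ℕ → ℕ) (i : ℕ) :
    (basicDiff b (Baire.pre m i, m i) : Set X) =
      (b (m i) : Set X) \ ⋃ j < i, (b (m j) : Set X) := by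
  rw [coe_basicDiff]
  congr 1
  ext x
  simp [mem_pre]

theorem disjoint_basicDiff_pre (b : ℕ → CompactOpens X) (m : ℕ → ℕ) {i j : ℕ} (hij : i ≠ j) :
    Disjoint (basicDiff b (Baire.pre m i, m i) : Set X)
      (basicDiff b (Baire.pre m j, m j) : Set X) := by
  wlog hlt : i < j generalizing i j
  · exact (this hij.symm (by omega)).symm
  rw [basicDiff_pre, basicDiff_pre, disjoint_left]
  exact fun x hx hx' => hx'.2 (mem_iUnion₂.2 ⟨i, hlt, hx.1⟩)

/-- A point survives the subtraction at the least index whose basic set contains it. -/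
theorem iUnion_basicDiff_pre (b : ℕ → CompactOpens X) (m : ℕ → ℕ) :
    ⋃ i, (basicDiff b (Baire.pre m i, m i) : Set X) = ⋃ i, (b (m i) : Set X) := by
  classical
  refine Subset.antisymm (iUnion_mono fun i => ?_) fun x hx => ?_
  · rw [basicDiff_pre]
    exact sdiff_subset
  · have hex := mem_iUnion.1 hx
    refine mem_iUnion.2 ⟨Nat.find hex, ?_⟩
    rw [basicDiff_pre]
    refine ⟨Nat.find_spec hex, fun hx => ?_⟩
    obtain ⟨j, hj, hxj⟩ := mem_iUnion₂.1 hx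
    exact Nat.find_min hex hj hxj

theorem HasComputableCompactOpenBasis.decompositionComputable
    (hX : HasComputableCompactOpenBasis X) : DecompositionComputable X := by
  obtain ⟨_, b₀, hb₀, hmap, rfl⟩ := hX
  obtain ⟨O₀, N₀, κ₀, h₀⟩ := exists_compactOpenNames hmap
  obtain ⟨b, O, N, κ, h, h0, hsucc⟩ := h₀.exists_cons_empty
  have hb : ∀ (x : X) (U : Set X), IsOpen U → x ∈ U → ∃ n, x ∈ b n ∧ (b n : Set X) ⊆ U := by
    intro x U hU hx
    obtain ⟨n, h1, h2⟩ := exists_basis_mem hb₀ x U hU hx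
    exact ⟨n + 1, by rwa [hsucc], by rwa [hsucc]⟩
  obtain ⟨blk, hblk, hB⟩ := h.exists_blocks h0 hb
  obtain ⟨bit, hbit, hbits⟩ := exists_emptinessBit h h0 hb
  let Z : List ℕ × ℕ → Baire := fun x => tuple (diffName O N κ x) (diffComplName O N x)
  have hZ : Computable₂ Z := computable_tuple (computable_diffName h) (computable_diffComplName h)
  let Q : List ℕ → Baire := fun l => outputName Z bit
    (fun i => ((listFlat blk l).take i, (listFlat blk l).getD i 0))
    fun i => (blk i (l.getD i 0)).length
  have hQ : Computable₂ Q := by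
    have hF : Computable fun x : List ℕ × ℕ => listFlat blk x.1 :=
      (computable_listFlat hblk).comp Computable.fst
    exact computable_outputName hZ hbit
      (Computable.pair (Primrec.list_take.to_comp.comp Computable.snd hF)
        ((Primrec.list_getD 0).to_comp.comp hF Computable.snd))
      (Computable.list_length.comp (hblk.comp Computable.snd
        ((Primrec.list_getD 0).to_comp.comp Computable.fst Computable.snd)))
  -- The name of the open set occupies the even input positions, and stage `k` inspects its entry
  -- `k.unpair.1`.
  obtain ⟨φ, hφ, H⟩ := produces_of_prefix (ι := fun k => 2 * k.unpair.1)
    (computable_stageIndex h.computable_κ)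
    (Primrec.nat_double.to_comp.comp (computable_fst Computable.id))
    (fun k => Nat.mul_le_mul_left 2 (Nat.unpair_left_le k)) hQ
  refine ⟨φ, hφ, ?_⟩
  rintro p ⟨U, K⟩ ⟨hpU, -⟩ hUK
  let c : Baire := fun k => stageIndex κ (p.fst k.unpair.1) k
  let B : ℕ → List ℕ := fun k => blk k (c k)
  have hBne : ∀ k, B k ≠ [] := fun k => (hB k (c k)).1
  let m : ℕ → ℕ := flatSeq B
  let x : ℕ → List ℕ × ℕ := fun i => (Baire.pre m i, m i)
  let r : ℕ → ℕ+ := fun k => ⟨(B k).length, List.length_pos_iff.2 (hBne k)⟩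
  -- The first `n + 1` blocks are nonempty, so they already determine every entry of index at most
  -- `n` that digit `n` can involve.
  have hout : (fun n => Q (c.pre (n + 1)) n) = outputName Z bit x fun i => r i := by
    ext n
    have hlen := le_length_flat hBne (n + 1)
    refine outputName_congr Z bit (fun i hi => ?_) fun i hi => ?_
    · rw [listFlat_pre]
      exact Prod.ext (flat_take hBne (by omega)) (flat_getD hBne (by omega))
    · rw [pre_getD (by omega)]
      rfl
  refine ⟨outputName Z bit x fun i => r i, ((fun i => basicDiff b (x i), r), fun i =>
    ⟨bit (x i), (hbits (x i)).1⟩), hout ▸ H p, ?_, _, _, _, rfl,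
    fun i j hij => disjoint_basicDiff_pre b m hij, ?_, hUK, fun i => ?_, fun n j hj => ?_⟩
  · refine ⟨⟨fun i => ?_, fun i => ?_⟩, fun i => ?_⟩
    · have : (outputName Z bit x fun i => r i).fst.fst.component i = Z (x i) := by
        ext j
        simp [outputName, Baire.component]
      rw [this]
      refine ⟨?_, ?_⟩
      · simp only [Z, tuple_fst]
        exact openSet_diffName h hb (x i)
      · simp only [Z, tuple_snd]
        rw [openSet_diffComplName h h0, compl_compl]
    · simp [outputName]
    · simp [outputName]
  · change ⋃ i, (basicDiff b (Baire.pre m i, m i) : Set X) = (U : Set X)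
    rw [iUnion_basicDiff_pre, ← show openSet X p.fst = U from hpU,
      ← h.iUnion_stageIndex h0 hb p.fst]
    refine Subset.antisymm (iUnion_subset fun i => ?_) (iUnion_subset fun k => ?_)
    · obtain ⟨n, hn⟩ := flatSeq_mem hBne i
      exact ((subset_iUnion₂ (s := fun m (_ : m ∈ B n) => (b m : Set X)) _ hn).trans
        (hB n (c n)).2.2.subset).trans (subset_iUnion (fun k => (b (c k) : Set X)) n)
    · change (b (c k) : Set X) ⊆ _
      rw [← (hB k (c k)).2.2]
      refine iUnion₂_subset fun l hl => ?_
      obtain ⟨i, rfl⟩ := exists_flatSeq_eq hBne hl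
      exact subset_iUnion (fun i => (b (m i) : Set X)) i
  · exact (hbits (x i)).2.trans (by rw [Fin.ext_iff]; rfl)
  -- The piece lies in a member of block `n`, whose diameter was bounded when the block was built.
  · have hm : m (∑ k ∈ Finset.range n, (r k : ℕ) + j) = (B n)[j] := flatSeq_sum_add hBne hj
    have hmem : m (∑ k ∈ Finset.range n, (r k : ℕ) + j) ∈ B n := hm ▸ List.getElem_mem hj
    refine (Metric.diam_mono ?_ (b _).isCompact.isBounded).trans_lt ((hB n (c n)).2.1 _ hmem)
    change (basicDiff b (Baire.pre m _, m _) : Set X) ⊆ _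
    rw [basicDiff_pre]
    exact sdiff_subset

theorem HasComputableCompactOpenBasis.hasComputableBasisWithCompactSupersets
    (hX : HasComputableCompactOpenBasis X) : HasComputableBasisWithCompactSupersets X := by
  obtain ⟨_, b, hb, hmap, rfl⟩ := hX
  obtain ⟨O, N, κ, h⟩ := exists_compactOpenNames hmap
  refine ⟨fun n => (⟨b n, (b n).isOpen⟩, (b n).toCompacts),
    computableMap_of_names (computable_tuple h.computable_O h.computable_κ) fun n => ?_, hb,
    fun n => Subset.rfl⟩
  simp [prodRep, openRep, h.openSet_O, h.compactRep_κ]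

end EffZeroDim

open EffZeroDim

theorem proposition7p3 (X : Type*) [ComputableMetricSpace X] :
    (DcComputable X → HasComputableCompactOpenBasis X) ∧
    (HasComputableCompactOpenBasis X ↔
      DecompositionComputable X ∧ HasComputableBasisWithCompactSupersets X) ∧
    (DecompositionComputable X ∧ HasComputableBasisWithCompactSupersets X →
      HasComputableClopenBasis X) :=
  have h32 : DecompositionComputable X ∧ HasComputableBasisWithCompactSupersets X →
      HasComputableCompactOpenBasis X := fun h => h.2.hasComputableCompactOpenBasis h.1
  ⟨DcComputable.hasComputableCompactOpenBasis,
    ⟨fun h => ⟨h.decompositionComputable, h.hasComputableBasisWithCompactSupersets⟩, h32⟩,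
    fun h => (h32 h).hasComputableClopenBasis⟩
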